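/- Definitions. A big interval is a linearly ordered set with at least two points which is dense, order-complete and has a minimum and a maximum; it carries its order topology. A big path in a space $X$ from $x$ to $y$ is a continuous map $\gamma\colon L\to X$ from a big interval with $\gamma(\min L)=x$, $\gamma(\max L)=y$. A space is big-path-connected if any two of its points are joined by a big path in it. For $n\in\mathbb N$, a space $X$ is $n$-(big-)path-flimsy if $|X|>n$ and, for every $S\subseteq X$, the subspace $X\setminus S$ is (big-)path-connected when $|S|<n$ and is not (big-)path-connected when $|S|=n$. Construction. Let $\mathbb S^1=[0,3]/(0\sim 3)$ with its Euclidean topology $\mathscr E$; let $L=[0,1]^{\mathbb N}$ with the lexicographic order and its order topology, $\ell_1=(\tfrac13,\tfrac13,\dots)$, $\ell_2=(\tfrac23,\tfrac23,\dots)$, $L_1=[\min L,\ell_1]$, $L_2=(\ell_1,\ell_2)$, $L_3=[\ell_2,\max L]$. Call partitions $\{A_1,A_2,A_3\}$ of $L$ and $\{B_1,B_2,B_3\}$ of $\mathbb S^1$ Bernstein rectangles if every closed $F\subseteq L\times\mathbb S^1$ either is covered by countably many sets of the form $\{\ell\}\times\mathbb S^1$ or $L\times\{z\}$, or meets all nine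 sets $A_i\times B_j$. Given such partitions, call $f\colon L\to\mathbb S^1$ admissible if, for all $i,j\in\{1,2,3\}$, it restricts to a bijection from $A_i\cap L_j$ onto $[i-1,i)\cap B_j$. For a map $f\colon L\to\mathbb S^1$ let $\mathscr T_f=\{U\subseteq\mathbb S^1 : U\in\mathscr E \text{ and } f^{-1}(U)\text{ is open in }L\}$. Theorem. (1) $L$ is a big interval, and Bernstein rectangles exist. (2) For all Bernstein rectangles $(A_i),(B_j)$ there is an admissible $f$ which is an everywhere dense Hamiltonian big path: $f\colon L\to(\mathbb S^1,\mathscr T_f)$ is a continuous bijection, and $f(I)$ is dense in $(\mathbb S^1,\mathscr E)$ for every non-empty open interval $I\subseteq L$. (3) For all Bernstein rectangles and every admissible $f$: $f$ is a bijection, continuous as a map to $X:=(\mathbb S^1,\mathscr T_f)$; $\mathscr T_f\subseteq\mathscr E$; a map $[0,1]\to\mathbb S^1$ is $\mathscr T_f$-continuous if and only if it is $\mathscr E$-continuous; $X$ is $2$-path-flimsy; yet $X\setminus\{x,y\}$ is big-path-connected for all distinct $x,y\in X$; in particular, $X$ is not $2$-big-path-flimsy. -/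

import Mathlib

open Set Topology

universe u

/-- A big interval: a dense (with at least two points), order-complete linear order having both a
minimum and a maximum. It is always used with its order topology. -/
structure IsBigInterval (L : Type*) [LinearOrder L] : Prop where
  nontrivial : Nontrivial L
  dense : ∀ x y : L, x < y → ∃ z, x < z ∧ z < y
  complete : ∀ S : Set L, S.Nonempty → BddAbove S → ∃ m, IsLUB S m
  exists_min : ∃ a : L, IsLeast univ a
  exists_max : ∃ b : L, IsGreatest univ b

/-- In the space `(X, t)`, any two points of `s` are joined by a big path with values in `s`,
i.e. the subspace `s` of `(X, t)` is big-path-connected (the empty set is big-path-connected). -/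
def IsBigPathConnected {X : Type u} (t : TopologicalSpace X) (s : Set X) : Prop :=
  ∀ x ∈ s, ∀ y ∈ s, ∃ (L : Type u) (_ : LinearOrder L) (_ : TopologicalSpace L),
    OrderTopology L ∧ IsBigInterval L ∧
    ∃ γ : L → X, Continuous γ ∧ (∀ l, γ l ∈ s) ∧
      (∀ a, IsLeast univ a → γ a = x) ∧ (∀ b, IsGreatest univ b → γ b = y)

/-- `(X, t)` is `n`-path-flimsy: it has more than `n` points, removing fewer than `n` points leaves
a path-connected space, and removing exactly `n` points never does. (The sets `Sᶜ` concerned are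
non-empty, so the convention for the empty set does not matter.) -/
def IsPathFlimsy {X : Type u} (t : TopologicalSpace X) (n : ℕ) : Prop :=
  (n : ℕ∞) < ENat.card X ∧
    ∀ S : Set X, (S.encard < n → IsPathConnected Sᶜ) ∧ (S.encard = n → ¬ IsPathConnected Sᶜ)

/-- `(X, t)` is `n`-big-path-flimsy. -/
def IsBigPathFlimsy {X : Type u} (t : TopologicalSpace X) (n : ℕ) : Prop :=
  (n : ℕ∞) < ENat.card X ∧
    ∀ S : Set X, (S.encard < n → IsBigPathConnected t Sᶜ) ∧
      (S.encard = n → ¬ IsBigPathConnected t Sᶜ)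

/-- `f : L → (C, T)` is a big path which is a bijection and which maps every non-empty open interval
of `L` to a dense subset of `(C, E)`. (Every non-empty open interval of a big interval, bounded or
not, contains some `(a, b)` with `a < b`.) -/
structure IsEverywhereDenseHamiltonianBigPath {L : Type*} [LinearOrder L] [TopologicalSpace L]
    [OrderTopology L] {C : Type*} (E T : TopologicalSpace C) (f : L → C) : Prop where
  isBigInterval : IsBigInterval L
  continuous : Continuous[_, T] f
  bijective : Function.Bijective f
  dense : ∀ a b : L, a < b → @Dense C E (f '' Ioo a b)

/-- The set `[0,1]^ℕ`, which carries the lexicographic order and its order topology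
(not the product topology). -/
def LexCube : Type := Lex (ℕ → unitInterval)

noncomputable instance : LinearOrder LexCube :=
  inferInstanceAs (LinearOrder (Lex (ℕ → unitInterval)))

noncomputable instance : TopologicalSpace LexCube := Preorder.topology LexCube

instance : OrderTopology LexCube := ⟨rfl⟩

/-- The constant sequence `(c, c, …)`. -/
def LexCube.const (c : unitInterval) : LexCube := toLex (fun _ : ℕ => c)

/-- The constant sequence `(1/3, 1/3, …)`. -/
noncomputable def LexCube.third : LexCube := LexCube.const ⟨1 / 3, by norm_num, by norm_num⟩

/-- The constant sequence `(2/3, 2/3, …)`. -/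
noncomputable def LexCube.twoThirds : LexCube := LexCube.const ⟨2 / 3, by norm_num, by norm_num⟩

/-- The partition of `LexCube` into `[min, ℓ₁]`, `(ℓ₁, ℓ₂)`, `[ℓ₂, max]`, where `ℓ₁`, `ℓ₂` are the
constant sequences `1/3` and `2/3`. -/
noncomputable def LexCube.part : Fin 3 → Set LexCube :=
  ![Iic LexCube.third, Ioo LexCube.third LexCube.twoThirds, Ici LexCube.twoThirds]

/-- The circle, as `ℝ / 3ℤ`, i.e. `[0,3]` with its ends identified; Mathlib's topology on it is the
Euclidean one. -/
abbrev Circle3 : Type := AddCircle (3 : ℝ)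

/-- The Euclidean topology of the circle. -/
abbrev euclideanTopology : TopologicalSpace Circle3 := inferInstance

/-- The image in the circle of the half-open interval `[i, i+1)`, for `i = 0, 1, 2`. -/
def arc (i : Fin 3) : Set Circle3 := (fun r : ℝ => (r : Circle3)) '' Ico (i : ℝ) ((i : ℝ) + 1)

/-- A partition into three (non-empty) sets. -/
structure IsPartition3 {Y : Type*} (A : Fin 3 → Set Y) : Prop where
  nonempty : ∀ i, (A i).Nonempty
  disjoint : ∀ i j, i ≠ j → Disjoint (A i) (A j)
  union : ⋃ i, A i = univ

/-- A line of `Y × Z`: a set `{y} × Z` or `Y × {z}`. -/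
def IsLine {Y Z : Type*} (l : Set (Y × Z)) : Prop :=
  (∃ y : Y, l = {y} ×ˢ univ) ∨ (∃ z : Z, l = univ ×ˢ {z})

/-- `F` is covered by countably many lines. -/
def CoveredByCountablyManyLines {Y Z : Type*} (F : Set (Y × Z)) : Prop :=
  ∃ C : Set (Set (Y × Z)), C.Countable ∧ (∀ l ∈ C, IsLine l) ∧ F ⊆ ⋃₀ C

/-- Partitions of `Y` and `Z` whose nine rectangles `A i × B j` are all met by every closed subset
of `Y × Z` that is not covered by countably many lines. -/
structure IsBernsteinRectangles {Y Z : Type*} [TopologicalSpace Y] [TopologicalSpace Z]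
    (A : Fin 3 → Set Y) (B : Fin 3 → Set Z) : Prop where
  left : IsPartition3 A
  right : IsPartition3 B
  meets : ∀ F : Set (Y × Z), IsClosed F →
    CoveredByCountablyManyLines F ∨ ∀ i j, (F ∩ A i ×ˢ B j).Nonempty

/-- `f` is glued from bijections of `A i ∩ L j` onto `[i, i+1) ∩ B j` (indices in `{0, 1, 2}`). -/
def IsGluedFromBijections (A : Fin 3 → Set LexCube) (B : Fin 3 → Set Circle3)
    (f : LexCube → Circle3) : Prop :=
  ∀ i j, BijOn f (A i ∩ LexCube.part j) (arc i ∩ B j)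

/-- The topology on the circle whose open sets are the Euclidean open sets `U` such that `f ⁻¹' U`
is open. -/
@[reducible] def mixedTopology (f : LexCube → Circle3) : TopologicalSpace Circle3 where
  IsOpen U := IsOpen[euclideanTopology] U ∧ IsOpen (f ⁻¹' U)
  isOpen_univ := ⟨isOpen_univ, isOpen_univ⟩
  isOpen_inter _ _ hU hV := ⟨hU.1.inter hV.1, hU.2.inter hV.2⟩
  isOpen_sUnion S hS := ⟨isOpen_sUnion fun U hU => (hS U hU).1, by
    rw [preimage_sUnion]
    exact isOpen_biUnion fun U hU => (hS U hU).2⟩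

/-! The crux is that a path `f ∘ ψ` in the mixed topology is Euclidean continuous. The cube and the
circle are compact and first countable. So a sequence of points whose positions converge in both
spaces becomes closed for the mixed topology once both limits are added. Hence near each time the
path stays close to its current position in the circle or in the cube (`eventually_mem_or_mem`). By
compactness, every point in the closure of the graph of `(ψ, f ∘ ψ)` over a closed interval shares a
coordinate with a point of the graph (`exists_of_mem_closure_graph`).

Suppose the path avoids part `j` and arc `i`. Since `f` sends `A i` into arc `i`, and only part `j`
is sent into `B j`, that closure misses `A i × B j`. The Bernstein property then covers it by
countably many lines, so `ψ` has countable image and closed fibres, and Sierpiński's theorem makes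
it constant. Two bootstraps remove the avoidance hypotheses. Every point of the circle has a
neighbourhood missing an arc, so a path avoiding a part is continuous into the cube, which contains
no nonconstant path. Every point of the cube has a neighbourhood missing a part, so a general path
is constant wherever it fails to be near its Euclidean position. Path-flimsiness is then inherited
from the circle.

For big paths, remove two points. Each of the three parts contains points that `f` sends to either
remaining arc. The two removed points cut the cube in two places, and each cut can separate such
points within only one part. So in some part a subinterval joins the arcs.

Bernstein rectangles come from a transfinite choice of points with pairwise distinct coordinates.
The cube has too many closed sets to list, so the recursion runs over countable sets whose closures
are large (`exists_isRich_closure_range`). A second transfinite choice makes the glued bijections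
send intervals to dense sets. -/

instance : Fact ((0 : ℝ) < 3) := ⟨by norm_num⟩

/-- A dense complete linear order with at least two points is a big interval. -/
theorem IsBigInterval.of_completeLinearOrder (L : Type*) [CompleteLinearOrder L]
    [DenselyOrdered L] [Nontrivial L] : IsBigInterval L where
  nontrivial := inferInstance
  dense _ _ h := exists_between h
  complete S _ _ := ⟨sSup S, isLUB_sSup S⟩
  exists_min := ⟨⊥, mem_univ _, fun _ _ => bot_le⟩
  exists_max := ⟨⊤, mem_univ _, fun _ _ => le_top⟩

theorem isBigInterval_unitInterval : IsBigInterval unitInterval :=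
  .of_completeLinearOrder _

/-! ### The lexicographic cube: completeness, compactness, first countability, cardinality. -/

namespace LexCube

/-- The `n`-th coordinate of a point of the cube. -/
def coord (x : LexCube) (n : ℕ) : unitInterval := ofLex x n

/-- The point of the cube with given coordinates. -/
def mk (x : ℕ → unitInterval) : LexCube := toLex x

@[simp] theorem coord_mk (x : ℕ → unitInterval) (n : ℕ) : (mk x).coord n = x n := rfl

theorem lt_iff {x y : LexCube} :
    x < y ↔ ∃ n, (∀ i < n, x.coord i = y.coord i) ∧ x.coord n < y.coord n := Iff.rfl

/-- The coordinates of the least upper bound of a set. -/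
noncomputable def sup (S : Set LexCube) : ℕ → unitInterval
  | n => sSup {t | ∃ y ∈ S, (∀ i : Fin n, y.coord i = sup S i) ∧ y.coord n = t}
decreasing_by exact i.2

/-- Both halves look at the first coordinate of disagreement: only members of `S` agreeing with the
supremum before it matter there. If there are none, the coordinate is `sSup ∅`, the least possible
value. -/
theorem isLUB_sup (S : Set LexCube) : IsLUB S (mk (sup S)) := by
  constructor
  · intro y hy
    by_contra! h
    obtain ⟨n, h1, h2⟩ := lt_iff.1 h
    refine h2.not_ge ?_
    rw [coord_mk, sup]
    exact le_sSup ⟨y, hy, fun i => (h1 i i.2).symm, rfl⟩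
  · intro u hu
    by_contra! h
    obtain ⟨n, h1, h2⟩ := lt_iff.1 h
    rw [coord_mk, sup, lt_sSup_iff] at h2
    obtain ⟨_, ⟨y, hy, h3, rfl⟩, h4⟩ := h2
    refine (hu hy).not_gt (lt_iff.2 ⟨n, fun i hi => ?_, h4⟩)
    rw [h1 i hi, h3 ⟨i, hi⟩, coord_mk]

instance : DenselyOrdered LexCube :=
  inferInstanceAs (DenselyOrdered (Lex (ℕ → unitInterval)))

instance : BoundedOrder LexCube :=
  inferInstanceAs (BoundedOrder (Lex (ℕ → unitInterval)))

theorem const_lt {c d : unitInterval} (h : c < d) : const c < const d :=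
  lt_iff.2 ⟨0, fun _ h => absurd h (Nat.not_lt_zero _), h⟩

theorem third_lt_twoThirds : third < twoThirds :=
  const_lt (Subtype.mk_lt_mk.2 (by norm_num))

instance : Nontrivial LexCube := ⟨_, _, third_lt_twoThirds.ne⟩

theorem isBigInterval : IsBigInterval LexCube where
  nontrivial := inferInstance
  dense _ _ h := exists_between h
  complete S _ _ := ⟨_, isLUB_sup S⟩
  exists_min := ⟨⊥, mem_univ _, fun _ _ => bot_le⟩
  exists_max := ⟨⊤, mem_univ _, fun _ _ => le_top⟩

instance : CompactSpace LexCube := by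
  let _ : SupSet LexCube := ⟨fun S => mk (sup S)⟩
  let _ : CompleteLinearOrder LexCube :=
    { LinearOrder.toBiheytingAlgebra LexCube, completeLatticeOfSup LexCube isLUB_sup,
      (inferInstance : LinearOrder LexCube) with }
  exact compactSpace_of_completeLinearOrder

/-- Every non-empty open interval of the cube contains a family of disjoint nondegenerate closed
intervals, indexed by `[0,1]`. -/
theorem exists_closed_subintervals {a b : LexCube} (h : a < b) :
    ∃ u v : unitInterval → LexCube,
      (∀ t, a < u t ∧ u t < v t ∧ v t < b) ∧ ∀ t t', t < t' → v t < u t' := by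
  obtain ⟨n, h1, h2⟩ := lt_iff.1 h
  obtain ⟨c, hac, hcb⟩ := exists_between h2
  -- Coordinate `n` is strictly between those of `a` and `b`, which keeps every `w t e` inside.
  -- Coordinate `n + 1` separates the intervals, and the tails `0` and `1` give their ends.
  let w (t e : unitInterval) : LexCube := mk fun k =>
    if k < n then a.coord k else if k = n then c else if k = n + 1 then t else e
  have hw (t e) : a < w t e ∧ w t e < b :=
    ⟨lt_iff.2 ⟨n, fun i hi => by simp [w, hi], by simpa [w] using hac⟩,
      lt_iff.2 ⟨n, fun i hi => by simp [w, hi, h1], by simpa [w] using hcb⟩⟩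
  refine ⟨fun t => w t 0, fun t => w t 1, fun t => ⟨(hw _ _).1, ?_, (hw _ _).2⟩, ?_⟩
  · refine lt_iff.2 ⟨n + 2, fun i hi => ?_, by simp [w]⟩
    have : i < n ∨ i = n ∨ i = n + 1 := by omega
    rcases this with h | h | h <;> simp [w, h]
  · intro t t' htt
    refine lt_iff.2 ⟨n + 1, fun i hi => ?_, by simpa [w] using htt⟩
    have : i < n ∨ i = n := by omega
    rcases this with h | h <;> simp [w, h]

/-- A smaller point first drops below `x` at some coordinate; replacing just that coordinate of `x`
by an element of a countable dense set fits in between. With its mirror image this gives first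
countability, hence sequential compactness. -/
theorem countable_cofinal_Iio (x : LexCube) :
    ∃ D : Set LexCube, D.Countable ∧ D ⊆ Iio x ∧ ∀ y < x, ∃ d ∈ D, y < d := by
  obtain ⟨Q, hQ, hd⟩ := TopologicalSpace.exists_countable_dense unitInterval
  refine ⟨{d | ∃ n, ∃ q ∈ Q, q < x.coord n ∧ d = mk (Function.update x.coord n q)}, ?_, ?_, ?_⟩
  · refine ((countable_univ (α := ℕ)).prod hQ).image
      (fun p => mk (Function.update x.coord p.1 p.2)) |>.mono ?_
    rintro d ⟨n, q, hq, -, rfl⟩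
    exact ⟨(n, q), ⟨mem_univ _, hq⟩, rfl⟩
  · rintro d ⟨n, q, hq, h, rfl⟩
    exact lt_iff.2 ⟨n, fun i hi => by simp [hi.ne], by simpa using h⟩
  · intro y hy
    obtain ⟨n, h1, h2⟩ := lt_iff.1 hy
    obtain ⟨q, hq, h3, h4⟩ := hd.exists_between h2
    exact ⟨_, ⟨n, q, hq, h4, rfl⟩, lt_iff.2 ⟨n, fun i hi => by simp [hi.ne, h1 i hi], by simpa⟩⟩

theorem countable_coinitial_Ioi (x : LexCube) :
    ∃ D : Set LexCube, D.Countable ∧ D ⊆ Ioi x ∧ ∀ y, x < y → ∃ d ∈ D, d < y := by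
  obtain ⟨Q, hQ, hd⟩ := TopologicalSpace.exists_countable_dense unitInterval
  refine ⟨{d | ∃ n, ∃ q ∈ Q, x.coord n < q ∧ d = mk (Function.update x.coord n q)}, ?_, ?_, ?_⟩
  · refine ((countable_univ (α := ℕ)).prod hQ).image
      (fun p => mk (Function.update x.coord p.1 p.2)) |>.mono ?_
    rintro d ⟨n, q, hq, -, rfl⟩
    exact ⟨(n, q), ⟨mem_univ _, hq⟩, rfl⟩
  · rintro d ⟨n, q, hq, h, rfl⟩
    exact lt_iff.2 ⟨n, fun i hi => by simp [hi.ne], by simpa using h⟩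
  · intro y hy
    obtain ⟨n, h1, h2⟩ := lt_iff.1 hy
    obtain ⟨q, hq, h3, h4⟩ := hd.exists_between h2
    exact ⟨_, ⟨n, q, hq, h3, rfl⟩, lt_iff.2 ⟨n, fun i hi => by simp [hi.ne, h1 i hi], by simpa⟩⟩

instance : FirstCountableTopology LexCube := by
  refine ⟨fun x => ?_⟩
  obtain ⟨D, hD, hD1, hD2⟩ := countable_cofinal_Iio x
  obtain ⟨E, hE, hE1, hE2⟩ := countable_coinitial_Ioi x
  have h : 𝓝 x = (⨅ d ∈ D, Filter.principal (Ioi d)) ⊓ ⨅ e ∈ E, Filter.principal (Iio e) := by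
    rw [nhds_eq_order]
    congr 1
    · refine le_antisymm (biInf_mono hD1) (le_iInf₂ fun y hy => ?_)
      obtain ⟨d, hd, hyd⟩ := hD2 y hy
      exact (iInf₂_le d hd).trans (Filter.principal_mono.2 (Ioi_subset_Ioi hyd.le))
    · refine le_antisymm (biInf_mono hE1) (le_iInf₂ fun y hy => ?_)
      obtain ⟨d, hd, hyd⟩ := hE2 y hy
      exact (iInf₂_le d hd).trans (Filter.principal_mono.2 (Iio_subset_Iio hyd.le))
  rw [h, iInf_subtype', iInf_subtype']
  have := hD.to_subtype
  have := hE.to_subtype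
  infer_instance

theorem cardinal_mk : Cardinal.mk LexCube = Cardinal.continuum := by
  have h : Cardinal.mk unitInterval = Cardinal.continuum := Cardinal.mk_Icc_real one_pos
  change Cardinal.mk (ℕ → unitInterval) = _
  simp [h]

theorem continuum_le_mk_of_forall_inter {s : Set LexCube} {a b : LexCube} (h : a < b)
    (hs : ∀ u v, a < u → u < v → v < b → (Icc u v ∩ s).Nonempty) :
    Cardinal.continuum ≤ Cardinal.mk ↥(s ∩ Ioo a b) := by
  obtain ⟨u, v, huv, hlt⟩ := exists_closed_subintervals h
  choose p hp using fun t => hs (u t) (v t) (huv t).1 (huv t).2.1 (huv t).2.2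
  rw [← Cardinal.mk_Icc_real (one_pos : (0 : ℝ) < 1)]
  refine Cardinal.mk_le_of_injective (f := fun t : unitInterval =>
    (⟨p t, (hp t).2, (huv t).1.trans_le (hp t).1.1, (hp t).1.2.trans_lt (huv t).2.2⟩ :
      ↥(s ∩ Ioo a b))) (StrictMono.injective fun t t' htt => ?_)
  exact (hp t).1.2.trans_lt ((hlt t t' htt).trans_le (hp t').1.1)

theorem not_countable_Ioo {a b : LexCube} (h : a < b) : ¬ (Ioo a b).Countable := by
  have := continuum_le_mk_of_forall_inter (s := univ) h fun u v _ huv _ => ⟨u, by simpa using huv.le⟩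
  rw [univ_inter] at this
  rw [← Cardinal.le_aleph0_iff_set_countable, not_le]
  exact Cardinal.aleph0_lt_continuum.trans_le this

end LexCube

/-! ### Transfinite choice. -/

open Cardinal in
/-- Greedy choice: if each `S k` contains points which are unrelated to any given set of fewer than
`#K` points, then pairwise unrelated points of all the sets `S k` can be chosen. -/
theorem exists_pairwise_choice {K P : Type u} (S : K → Set P) (R : P → P → Prop)
    (hR : ∀ p q, R p q → R q p)
    (h : ∀ k, ∀ Q : Set P, #Q < #K → ∃ p ∈ S k, ∀ q ∈ Q, ¬ R p q) :
    ∃ g : K → P, (∀ k, g k ∈ S k) ∧ ∀ k k', k ≠ k' → ¬ R (g k) (g k') := by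
  -- The well-order has the least possible type, so each initial segment has fewer than `#K`
  -- elements.
  obtain ⟨r, wo, hr⟩ := Cardinal.exists_ord_eq K
  have key (k : K) (g : ∀ k', r k' k → P) :
      ∃ p ∈ S k, ∀ k' (hk : r k' k), ¬ R p (g k' hk) := by
    obtain ⟨p, hp, hq⟩ := h k (range fun k' : {k' // r k' k} => g k'.1 k'.2)
      (mk_range_le.trans_lt (card_typein_lt k hr))
    exact ⟨p, hp, fun k' hk => hq _ ⟨⟨k', hk⟩, rfl⟩⟩
  choose F hF hFR using key
  let g : K → P := wo.wf.fix F
  have hg (k : K) : g k = F k fun k' _ => g k' := wo.wf.fix_eq F k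
  have hlt {k k' : K} (hk : r k' k) : ¬ R (g k) (g k') := by
    rw [hg k]
    exact hFR k _ k' hk
  refine ⟨g, fun k => hg k ▸ hF k _, fun k k' hne => ?_⟩
  rcases trichotomous_of r k k' with hk | hk | hk
  · exact fun hc => hlt hk (hR _ _ hc)
  · exact absurd hk hne
  · exact hlt hk

/-! ### Covers by countably many lines, and existence of Bernstein rectangles. -/

section Lines

variable {Y Z : Type}

theorem CoveredByCountablyManyLines.mono {F G : Set (Y × Z)} (hG : CoveredByCountablyManyLines G)
    (h : F ⊆ G) : CoveredByCountablyManyLines F :=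
  let ⟨C, h1, h2, h3⟩ := hG
  ⟨C, h1, h2, h.trans h3⟩

theorem coveredByCountablyManyLines_iUnion {ι : Type*} [Countable ι] {F : ι → Set (Y × Z)}
    (h : ∀ i, CoveredByCountablyManyLines (F i)) : CoveredByCountablyManyLines (⋃ i, F i) := by
  choose C h1 h2 h3 using h
  refine ⟨⋃ i, C i, countable_iUnion h1, fun l hl => ?_, iUnion_subset fun i => ?_⟩
  · obtain ⟨i, hi⟩ := mem_iUnion.1 hl
    exact h2 i l hi
  · exact (h3 i).trans (sUnion_mono (subset_iUnion C i))

theorem CoveredByCountablyManyLines.union {F G : Set (Y × Z)} (hF : CoveredByCountablyManyLines F)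
    (hG : CoveredByCountablyManyLines G) : CoveredByCountablyManyLines (F ∪ G) := by
  rw [union_eq_iUnion]
  exact coveredByCountablyManyLines_iUnion (by simp [hF, hG])

theorem coveredByCountablyManyLines_empty : CoveredByCountablyManyLines (∅ : Set (Y × Z)) :=
  ⟨∅, countable_empty, by simp, empty_subset _⟩

theorem IsLine.covered {l : Set (Y × Z)} (h : IsLine l) : CoveredByCountablyManyLines l :=
  ⟨{l}, countable_singleton l, by simpa, by simp⟩

/-- A set covered by countably many lines lies over countably many points of one of the factors. -/
theorem CoveredByCountablyManyLines.exists_countable {F : Set (Y × Z)}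
    (h : CoveredByCountablyManyLines F) :
    ∃ (P : Set Y) (Q : Set Z), P.Countable ∧ Q.Countable ∧ ∀ p ∈ F, p.1 ∈ P ∨ p.2 ∈ Q := by
  obtain ⟨C, hC, hl, hF⟩ := h
  rcases F.eq_empty_or_nonempty with rfl | ⟨p₀, -⟩
  · exact ⟨∅, ∅, countable_empty, countable_empty, by simp⟩
  refine ⟨(fun y => {y} ×ˢ univ) ⁻¹' C, (fun z => univ ×ˢ {z}) ⁻¹' C,
    hC.preimage fun y y' hy => ?_, hC.preimage fun z z' hz => ?_, fun p hp => ?_⟩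
  · have : (y, p₀.2) ∈ ({y'} ×ˢ univ : Set (Y × Z)) := hy ▸ ⟨rfl, mem_univ _⟩
    exact this.1
  · have : (p₀.1, z) ∈ (univ ×ˢ {z'} : Set (Y × Z)) := hz ▸ ⟨mem_univ _, rfl⟩
    exact this.2
  · obtain ⟨l, hlC, hpl⟩ := hF hp
    rcases hl l hlC with ⟨y, rfl⟩ | ⟨z, rfl⟩
    · left
      obtain rfl : p.1 = y := hpl.1
      exact hlC
    · right
      obtain rfl : p.2 = z := hpl.2
      exact hlC

theorem not_coveredByCountablyManyLines_prod {P : Set Y} {Q : Set Z} (hP : ¬ P.Countable)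
    (hQ : ¬ Q.Countable) : ¬ CoveredByCountablyManyLines (P ×ˢ Q) := by
  intro h
  obtain ⟨P', Q', hP', hQ', hc⟩ := h.exists_countable
  obtain ⟨y, hy, hy'⟩ := not_subset.1 fun h => hP (hP'.mono h)
  obtain ⟨z, hz, hz'⟩ := not_subset.1 fun h => hQ (hQ'.mono h)
  exact (hc (y, z) ⟨hy, hz⟩).elim hy' hz'

variable [TopologicalSpace Y] [TopologicalSpace Z]

theorem IsCompact.coveredByCountablyManyLines {F : Set (Y × Z)} (hF : IsCompact F)
    (h : ∀ p ∈ F, ∃ N ∈ 𝓝 p, CoveredByCountablyManyLines (F ∩ N)) :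
    CoveredByCountablyManyLines F := by
  refine (hF.induction_on (p := fun G => CoveredByCountablyManyLines (F ∩ G)) ?_ ?_ ?_ ?_).mono
    (subset_inter Subset.rfl Subset.rfl)
  · simpa using coveredByCountablyManyLines_empty
  · exact fun s t hst ht => ht.mono (inter_subset_inter_right F hst)
  · intro s t hs ht
    rw [inter_union_distrib_left]
    exact hs.union ht
  · intro p hp
    obtain ⟨N, hN, hc⟩ := h p hp
    exact ⟨N, mem_nhdsWithin_of_mem_nhds hN, hc⟩

/-- A compact set which is locally small off a line is small. -/
theorem IsCompact.coveredByCountablyManyLines_of_line [T1Space Y] [T1Space Z]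
    [FirstCountableTopology Y] [FirstCountableTopology Z] {F l : Set (Y × Z)} (hF : IsCompact F)
    (hl : IsLine l) (h : ∀ p ∈ F \ l, ∃ N ∈ 𝓝 p, CoveredByCountablyManyLines (F ∩ N)) :
    CoveredByCountablyManyLines F := by
  -- Points are Gδ by first countability, hence so are lines. The part of `F` off the line is
  -- therefore a countable union of compact sets.
  have hG : IsGδ l := by
    rcases hl with ⟨y, rfl⟩ | ⟨z, rfl⟩
    · simpa [prod_univ] using (IsGδ.singleton y).preimage continuous_fst
    · simpa [univ_prod] using (IsGδ.singleton z).preimage continuous_snd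
  obtain ⟨U, hU, rfl⟩ := isGδ_iff_eq_iInter_nat.1 hG
  have hs (n : ℕ) : CoveredByCountablyManyLines (F ∩ (U n)ᶜ) := by
    refine (hF.inter_right (hU n).isClosed_compl).coveredByCountablyManyLines fun p hp => ?_
    obtain ⟨N, hN, hc⟩ := h p ⟨hp.1, fun hpU => hp.2 (mem_iInter.1 hpU n)⟩
    exact ⟨N, hN, hc.mono (inter_subset_inter_left N inter_subset_left)⟩
  refine ((coveredByCountablyManyLines_iUnion hs).union hl.covered).mono fun p hp => ?_
  by_cases hpl : p ∈ ⋂ n, U n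
  · exact Or.inr hpl
  · obtain ⟨n, hn⟩ := not_forall.1 (mt mem_iInter.2 hpl)
    exact Or.inl (mem_iUnion.2 ⟨n, hp, hn⟩)

variable [CompactSpace Y] [CompactSpace Z] [T2Space Y] [T2Space Z]
  [FirstCountableTopology Y] [FirstCountableTopology Z]

/-- A closed set which is not covered by countably many lines contains two such sets with disjoint
projections to both factors. -/
theorem exists_split_of_not_covered {F : Set (Y × Z)} (hF : IsClosed F)
    (hc : ¬ CoveredByCountablyManyLines F) :
    ∃ G : Bool → Set (Y × Z), (∀ b, IsClosed (G b) ∧ ¬ CoveredByCountablyManyLines (G b) ∧ G b ⊆ F) ∧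
      ∀ p ∈ G true, ∀ q ∈ G false, p.1 ≠ q.1 ∧ p.2 ≠ q.2 := by
  -- The points where `F` is locally large. They do not lie on a single line, which forces two of
  -- them to differ in both coordinates.
  let H : Set (Y × Z) := {p ∈ F | ∀ N ∈ 𝓝 p, ¬ CoveredByCountablyManyLines (F ∩ N)}
  suffices ∃ p ∈ H, ∃ q ∈ H, p.1 ≠ q.1 ∧ p.2 ≠ q.2 by
    obtain ⟨p, hp, q, hq, h1, h2⟩ := this
    obtain ⟨U1, hU1, oU1, V1, hV1, oV1, hd1⟩ := exists_open_nhds_disjoint_closure h1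
    obtain ⟨U2, hU2, oU2, V2, hV2, oV2, hd2⟩ := exists_open_nhds_disjoint_closure h2
    refine ⟨fun b => F ∩ (b.rec (closure V1 ×ˢ closure V2) (closure U1 ×ˢ closure U2)), ?_, ?_⟩
    · rintro (_ | _)
      · refine ⟨hF.inter (isClosed_closure.prod isClosed_closure), hq.2 _ ?_, inter_subset_left⟩
        exact Filter.mem_of_superset ((oV1.prod oV2).mem_nhds ⟨hV1, hV2⟩)
          (prod_mono subset_closure subset_closure)
      · refine ⟨hF.inter (isClosed_closure.prod isClosed_closure), hp.2 _ ?_, inter_subset_left⟩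
        exact Filter.mem_of_superset ((oU1.prod oU2).mem_nhds ⟨hU1, hU2⟩)
          (prod_mono subset_closure subset_closure)
    · rintro x ⟨-, hx1, hx2⟩ y ⟨-, hy1, hy2⟩
      exact ⟨hd1.ne_of_mem hx1 hy1, hd2.ne_of_mem hx2 hy2⟩
  by_contra! hH
  have hline (l : Set (Y × Z)) (hl : IsLine l) : ∃ p ∈ H, p ∉ l := by
    by_contra! hHl
    refine hc (hF.isCompact.coveredByCountablyManyLines_of_line hl fun p hp => ?_)
    by_contra! hN
    exact hp.2 (hHl p ⟨hp.1, hN⟩)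
  have hne : H.Nonempty := by
    by_contra hne
    refine hc (hF.isCompact.coveredByCountablyManyLines fun p hp => ?_)
    by_contra! hN
    exact hne ⟨p, hp, hN⟩
  obtain ⟨p, hp⟩ := hne
  obtain ⟨q, hq, hqp⟩ := hline _ (Or.inl ⟨p.1, rfl⟩)
  obtain ⟨r, hr, hrp⟩ := hline _ (Or.inr ⟨p.2, rfl⟩)
  have hq1 : p.1 ≠ q.1 := fun h => hqp ⟨h.symm, mem_univ _⟩
  have hr2 : p.2 ≠ r.2 := fun h => hrp ⟨mem_univ _, h.symm⟩
  have hr1 : p.1 = r.1 := by_contra fun h => hr2 (hH p hp r hr h)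
  exact hr2 ((hH p hp q hq hq1).trans (hH q hq r hr fun h => hq1 (hr1.trans h.symm)))

/-- A set which is not covered by fewer than continuum many lines. -/
def IsRich (F : Set (Y × Z)) : Prop :=
  ∀ (P : Set Y) (Q : Set Z), Cardinal.mk P < Cardinal.continuum →
    Cardinal.mk Q < Cardinal.continuum → ∃ p ∈ F, p.1 ∉ P ∧ p.2 ∉ Q

open PiNat in
/-- A closed set which is not covered by countably many lines contains a countable set whose
closure is not covered by fewer than continuum many lines. -/
theorem exists_isRich_closure_range {F : Set (Y × Z)} (hF : IsClosed F)
    (hc : ¬ CoveredByCountablyManyLines F) :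
    ∃ d : List Bool → Y × Z, range d ⊆ F ∧ IsRich (closure (range d)) := by
  let T := {G : Set (Y × Z) // IsClosed G ∧ ¬ CoveredByCountablyManyLines G}
  choose S hS hSd using fun G : T => exists_split_of_not_covered G.2.1 G.2.2
  -- A Cantor scheme of splittings. With one point chosen per node, compactness gives each branch a
  -- point in the closure of the chosen points. Different branches yield points differing in both
  -- coordinates, so a line contains at most one of them.
  let G : List Bool → T := fun σ => σ.rec ⟨F, hF, hc⟩ fun b _ G => ⟨S G b, (hS G b).1, (hS G b).2.1⟩
  have hsub (b : Bool) (σ : List Bool) : (G (b :: σ)).1 ⊆ (G σ).1 := (hS (G σ) b).2.2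
  have hne (σ : List Bool) : (G σ).1.Nonempty := by
    by_contra h
    exact (G σ).2.2 (not_nonempty_iff_eq_empty.1 h ▸ coveredByCountablyManyLines_empty)
  choose d hd using hne
  have hFG (σ : List Bool) : (G σ).1 ⊆ F := by
    induction σ with
    | nil => exact Subset.rfl
    | cons b σ ih => exact (hsub b σ).trans ih
  have hbr (b : ℕ → Bool) : (⋂ n, closure (range d) ∩ (G (res b n)).1).Nonempty := by
    refine IsCompact.nonempty_iInter_of_sequence_nonempty_isCompact_isClosed _
      (fun n => inter_subset_inter_right _ (hsub _ _))
      (fun n => ⟨d (res b n), subset_closure ⟨_, rfl⟩, hd _⟩) ?_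
      fun n => isClosed_closure.inter (G _).2.1
    exact (isClosed_closure.inter (G (res b 0)).2.1).isCompact
  choose p hp using hbr
  have hpG (b : ℕ → Bool) (n : ℕ) : p b ∈ (G (res b n)).1 := (mem_iInter.1 (hp b) n).2
  have hinj {b b' : ℕ → Bool} (h : b ≠ b') : (p b).1 ≠ (p b').1 ∧ (p b).2 ≠ (p b').2 := by
    have h1 : res b (firstDiff b b') = res b' (firstDiff b b') :=
      res_eq_res.2 fun m hm => apply_eq_of_lt_firstDiff hm
    have h2 := apply_firstDiff_ne h
    have h3 := hpG b (firstDiff b b' + 1)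
    have h4 := hpG b' (firstDiff b b' + 1)
    rw [res_succ] at h3 h4
    rw [← h1] at h4
    generalize b (firstDiff b b') = x at *
    generalize b' (firstDiff b b') = y at *
    cases x <;> cases y
    · exact absurd rfl h2
    · exact (hSd _ _ h4 _ h3).imp Ne.symm Ne.symm
    · exact hSd _ _ h3 _ h4
    · exact absurd rfl h2
  refine ⟨d, range_subset_iff.2 fun σ => hFG σ (hd σ), fun P Q hP hQ => ?_⟩
  by_contra! hPQ
  let P' := (fun b => (p b).1) ⁻¹' P
  let Q' := (fun b => (p b).2) ⁻¹' Q
  have hu : P' ∪ Q' = univ := eq_univ_of_forall fun b =>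
    or_iff_not_imp_left.2 fun h => hPQ (p b) (mem_iInter.1 (hp b) 0).1 h
  have hP' : Cardinal.mk P' < Cardinal.continuum :=
    (Cardinal.mk_preimage_of_injective _ P
      fun b b' h => by_contra fun hne => (hinj hne).1 h).trans_lt hP
  have hQ' : Cardinal.mk Q' < Cardinal.continuum :=
    (Cardinal.mk_preimage_of_injective _ Q
      fun b b' h => by_contra fun hne => (hinj hne).2 h).trans_lt hQ
  have h := (Cardinal.mk_union_le P' Q').trans_lt
    (Cardinal.add_lt_of_lt Cardinal.aleph0_le_continuum hP' hQ')
  rw [hu, Cardinal.mk_univ] at h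
  simp at h

/-- Compact first countable Hausdorff spaces with continuum many points have Bernstein
rectangles. -/
theorem exists_isBernsteinRectangles (hY : Cardinal.mk Y = Cardinal.continuum)
    (hZ : Cardinal.mk Z = Cardinal.continuum) :
    ∃ (A : Fin 3 → Set Y) (B : Fin 3 → Set Z), IsBernsteinRectangles A B := by
  -- Indexing by countable families rather than by closed sets keeps the number of tasks at most
  -- continuum.
  let K := {d : List Bool → Y × Z // IsRich (closure (range d))} × Fin 3 × Fin 3
  have hK : Cardinal.mk K ≤ Cardinal.continuum := by
    have h1 : Cardinal.mk (List Bool → Y × Z) ≤ Cardinal.continuum := by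
      simp [hY, hZ]
    have h2 := (Cardinal.mk_subtype_le fun d : List Bool → Y × Z =>
      IsRich (closure (range d))).trans h1
    have h3 : Cardinal.mk (Fin 3 × Fin 3) ≤ Cardinal.continuum :=
      (Cardinal.lt_aleph0_of_finite _).le.trans Cardinal.aleph0_le_continuum
    rw [← Cardinal.continuum_mul_self, Cardinal.mk_prod, Cardinal.lift_id, Cardinal.lift_id]
    exact mul_le_mul' h2 h3
  obtain ⟨g, hg, hgR⟩ := exists_pairwise_choice (fun k : K => closure (range k.1.1))
    (fun p q => p.1 = q.1 ∨ p.2 = q.2) (fun p q h => h.imp Eq.symm Eq.symm) fun k Q hQ => by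
      obtain ⟨p, hp, h1, h2⟩ := k.1.2 (Prod.fst '' Q) (Prod.snd '' Q)
        (Cardinal.mk_image_le.trans_lt (hQ.trans_le hK))
        (Cardinal.mk_image_le.trans_lt (hQ.trans_le hK))
      refine ⟨p, hp, fun q hq h => h.elim (fun h => h1 ⟨q, hq, h.symm⟩) fun h => h2 ⟨q, hq, h.symm⟩⟩
  have inj1 : Function.Injective fun k => (g k).1 := fun k k' h =>
    by_contra fun hne => hgR k k' hne (Or.inl h)
  have inj2 : Function.Injective fun k => (g k).2 := fun k k' h =>
    by_contra fun hne => hgR k k' hne (Or.inr h)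
  let a : Y → Fin 3 := Function.extend (fun k => (g k).1) (fun k => k.2.1) fun _ => 0
  let b : Z → Fin 3 := Function.extend (fun k => (g k).2) (fun k => k.2.2) fun _ => 0
  have ha (k : K) : a (g k).1 = k.2.1 := inj1.extend_apply _ _ k
  have hb (k : K) : b (g k).2 = k.2.2 := inj2.extend_apply _ _ k
  have hmeets (F : Set (Y × Z)) (hF : IsClosed F) : CoveredByCountablyManyLines F ∨
      ∀ i j, (F ∩ (a ⁻¹' {i}) ×ˢ (b ⁻¹' {j})).Nonempty := by
    refine or_iff_not_imp_left.2 fun hc i j => ?_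
    obtain ⟨d, hdF, hd⟩ := exists_isRich_closure_range hF hc
    exact ⟨g (⟨d, hd⟩, i, j), closure_minimal hdF hF (hg (⟨d, hd⟩, i, j)), ha _, hb _⟩
  have huncY : ¬ (univ : Set Y).Countable := fun h => by
    have := Cardinal.le_aleph0_iff_set_countable.2 h
    rw [Cardinal.mk_univ, hY] at this
    exact Cardinal.aleph0_lt_continuum.not_ge this
  have huncZ : ¬ (univ : Set Z).Countable := fun h => by
    have := Cardinal.le_aleph0_iff_set_countable.2 h
    rw [Cardinal.mk_univ, hZ] at this
    exact Cardinal.aleph0_lt_continuum.not_ge this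
  have hne := (hmeets _ (isClosed_univ.prod isClosed_univ)).resolve_left
    (not_coveredByCountablyManyLines_prod huncY huncZ)
  refine ⟨fun i => a ⁻¹' {i}, fun j => b ⁻¹' {j}, ⟨fun i => ?_, fun i j hij => ?_, ?_⟩,
    ⟨fun j => ?_, fun i j hij => ?_, ?_⟩, hmeets⟩
  · exact let ⟨p, hp⟩ := hne i 0; ⟨p.1, hp.2.1⟩
  · exact disjoint_left.2 fun y h1 h2 => hij (h1.symm.trans h2)
  · exact eq_univ_of_forall fun y => mem_iUnion.2 ⟨a y, rfl⟩
  · exact let ⟨p, hp⟩ := hne 0 j; ⟨p.2, hp.2.2⟩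
  · exact disjoint_left.2 fun y h1 h2 => hij (h1.symm.trans h2)
  · exact eq_univ_of_forall fun y => mem_iUnion.2 ⟨b y, rfl⟩

end Lines

/-! ### Bijections meeting continuum many requirements. -/

section Matching

open Cardinal

/-- Two sets of size continuum are equivalent by a bijection under which given pairs of large
subsets, at most continuum many, are related. -/
theorem exists_equiv_meeting {X W α : Type} (hX : #X = 𝔠) (hW : #W = 𝔠) (hα : #α ≤ 𝔠)
    (S : α → Set X) (T : α → Set W) (hS : ∀ a, 𝔠 ≤ #(S a)) (hT : ∀ a, 𝔠 ≤ #(T a)) :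
    ∃ e : X ≃ W, ∀ a, ∃ x ∈ S a, e x ∈ T a := by
  have hK : #(α ⊕ ℝ) ≤ 𝔠 := by
    rw [mk_sum, lift_id, lift_id, mk_real]
    exact (add_le_add hα le_rfl).trans continuum_add_self.le
  have big {V : Type} {s : Set V} (hs : 𝔠 ≤ #s) {t : Set V} (ht : #t < 𝔠) : ∃ v ∈ s, v ∉ t := by
    by_contra! h
    exact (hs.trans (mk_le_mk_of_subset h)).not_gt ht
  have hS' (k : α ⊕ ℝ) : 𝔠 ≤ #(k.elim S fun _ => (univ : Set X) : Set X) := by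
    cases k
    · exact hS _
    · simp [hX]
  have hT' (k : α ⊕ ℝ) : 𝔠 ≤ #(k.elim T fun _ => (univ : Set W) : Set W) := by
    cases k
    · exact hT _
    · simp [hW]
  -- The indices in `ℝ` carry no requirement. Their pairs are reserves that leave continuum many
  -- points free on both sides, so that the partial bijection given by `α` extends.
  obtain ⟨g, hg, hgR⟩ := exists_pairwise_choice
    (fun k : α ⊕ ℝ => (k.elim S fun _ => univ) ×ˢ (k.elim T fun _ => univ))
    (fun p q => p.1 = q.1 ∨ p.2 = q.2) (fun p q h => h.imp Eq.symm Eq.symm) fun k Q hQ => by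
      obtain ⟨x, hx, hx'⟩ := big (hS' k) (mk_image_le (f := Prod.fst).trans_lt (hQ.trans_le hK))
      obtain ⟨y, hy, hy'⟩ := big (hT' k) (mk_image_le (f := Prod.snd).trans_lt (hQ.trans_le hK))
      exact ⟨(x, y), ⟨hx, hy⟩, fun q hq h =>
        h.elim (fun h => hx' ⟨q, hq, h.symm⟩) fun h => hy' ⟨q, hq, h.symm⟩⟩
  have inj1 : Function.Injective fun k => (g k).1 := fun k k' h =>
    by_contra fun hne => hgR k k' hne (Or.inl h)
  have inj2 : Function.Injective fun k => (g k).2 := fun k k' h =>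
    by_contra fun hne => hgR k k' hne (Or.inr h)
  let g₁ : α → X := fun a => (g (.inl a)).1
  let g₂ : α → W := fun a => (g (.inl a)).2
  have inj1' : Function.Injective g₁ := inj1.comp Sum.inl_injective
  have inj2' : Function.Injective g₂ := inj2.comp Sum.inl_injective
  let f : range g₁ ↪ W := ((Equiv.ofInjective g₁ inj1').symm.toEmbedding).trans ⟨g₂, inj2'⟩
  have hf (a : α) : f ⟨g₁ a, a, rfl⟩ = g₂ a := by
    change g₂ ((Equiv.ofInjective g₁ inj1').symm ⟨g₁ a, a, rfl⟩) = g₂ a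
    rw [Equiv.ofInjective_symm_apply]
  have compl_card {V : Type} (hV : #V = 𝔠) (s : Set V) (i : ℝ → V) (hi : Function.Injective i)
      (his : ∀ r, i r ∉ s) : #↥(sᶜ) = 𝔠 := by
    refine le_antisymm (hV ▸ mk_set_le _) ?_
    rw [← mk_real]
    exact mk_le_of_injective (f := fun r => (⟨i r, his r⟩ : ↥(sᶜ)))
      fun r r' h => hi (congrArg Subtype.val h)
  have c1 : #↥((range g₁)ᶜ) = 𝔠 := by
    refine compl_card hX _ (fun r => (g (.inr r)).1) (inj1.comp Sum.inr_injective) ?_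
    rintro r ⟨a, ha⟩
    exact Sum.inl_ne_inr (inj1 ha)
  have c2 : #↥((range f)ᶜ) = 𝔠 := by
    refine compl_card hW _ (fun r => (g (.inr r)).2) (inj2.comp Sum.inr_injective) ?_
    rintro r ⟨⟨_, a, rfl⟩, ha⟩
    rw [hf] at ha
    exact Sum.inl_ne_inr (inj2 ha)
  obtain ⟨e, he⟩ := extend_function f (Cardinal.eq.1 (c1.trans c2.symm))
  refine ⟨e, fun a => ⟨g₁ a, (hg (.inl a)).1, ?_⟩⟩
  rw [he ⟨g₁ a, a, rfl⟩, hf]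
  exact (hg (.inl a)).2

theorem exists_bijOn_meeting {Y Z α : Type} (hY : #Y = 𝔠) (hZ : #Z = 𝔠) (hα : #α ≤ 𝔠)
    {X : Set Y} {W : Set Z} (hX : 𝔠 ≤ #X) (hW : 𝔠 ≤ #W) (S : α → Set Y) (T : α → Set Z)
    (hS : ∀ a, 𝔠 ≤ #↥(X ∩ S a)) (hT : ∀ a, 𝔠 ≤ #↥(W ∩ T a)) :
    ∃ f : Y → Z, BijOn f X W ∧ ∀ a, ∃ x ∈ X ∩ S a, f x ∈ T a := by
  have pre {V : Type} (s t : Set V) (h : 𝔠 ≤ #↥(s ∩ t)) : 𝔠 ≤ #((↑) ⁻¹' t : Set s) := by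
    rw [← Subtype.image_preimage_val] at h
    exact h.trans mk_image_le
  obtain ⟨e, he⟩ := exists_equiv_meeting (le_antisymm (hY ▸ mk_set_le X) hX)
    (le_antisymm (hZ ▸ mk_set_le W) hW) hα (fun a => ((↑) ⁻¹' S a : Set X))
    (fun a => ((↑) ⁻¹' T a : Set W)) (fun a => pre _ _ (hS a)) (fun a => pre _ _ (hT a))
  have : Nonempty Z := mk_ne_zero_iff.1 (hZ ▸ continuum_ne_zero)
  let f : Y → Z := Function.extend ((↑) : X → Y) (fun x => (e x : Z)) fun _ => Classical.arbitrary Z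
  have hf (x : X) : f x = e x := Subtype.val_injective.extend_apply _ _ x
  refine ⟨f, ⟨fun x hx => hf ⟨x, hx⟩ ▸ (e _).2, fun x hx y hy h => ?_, fun z hz => ?_⟩, fun a => ?_⟩
  · rw [hf ⟨x, hx⟩, hf ⟨y, hy⟩] at h
    exact congrArg Subtype.val (e.injective (Subtype.ext h))
  · exact ⟨e.symm ⟨z, hz⟩, (e.symm _).2, by rw [hf, e.apply_symm_apply]⟩
  · obtain ⟨x, hx, hxT⟩ := he a
    exact ⟨x, ⟨x.2, hx⟩, hf x ▸ hxT⟩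

end Matching

/-! ### Arcs of the circle and parts of the cube. -/

section Circle

theorem Circle3.cardinal_mk : Cardinal.mk Circle3 = Cardinal.continuum :=
  (Cardinal.mk_congr (AddCircle.equivIco (3 : ℝ) 0)).trans (Cardinal.mk_Ico_real (by norm_num))

theorem Circle3.coe_injOn_Icc {a b : ℝ} (h : b < a + 3) :
    InjOn (fun r : ℝ => (r : Circle3)) (Icc a b) := fun _ hx _ hy hxy =>
  (AddCircle.coe_eq_coe_iff_of_mem_Ico ⟨hx.1, hx.2.trans_lt h⟩ ⟨hy.1, hy.2.trans_lt h⟩).1 hxy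

theorem mem_arc_of_mem {i : Fin 3} {r : ℝ} (h1 : i ≤ r) (h2 : r < i + 1) : (r : Circle3) ∈ arc i :=
  ⟨r, ⟨h1, h2⟩, rfl⟩

theorem exists_mem_arc (z : Circle3) : ∃ i, z ∈ arc i := by
  obtain ⟨r, ⟨h0, h3⟩, rfl⟩ := (AddCircle.coe_image_Ico_eq (3 : ℝ) 0).ge (mem_univ z)
  rcases lt_or_ge r 1 with h1 | h1
  · exact ⟨0, mem_arc_of_mem (by simpa) (by simpa)⟩
  rcases lt_or_ge r 2 with h2 | h2
  · exact ⟨1, mem_arc_of_mem (by simpa) (by norm_num; linarith)⟩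
  · exact ⟨2, mem_arc_of_mem (by simpa) (by norm_num; linarith)⟩

theorem arc_disjoint {i j : Fin 3} (hij : i ≠ j) : Disjoint (arc i) (arc j) := by
  rw [disjoint_left]
  rintro _ ⟨r, hr, rfl⟩ ⟨s, hs, hrs⟩
  have h0 (i : Fin 3) : (0 : ℝ) ≤ i ∧ (i : ℝ) + 1 ≤ 0 + 3 :=
    ⟨by positivity, by exact_mod_cast Nat.add_le_of_le_sub (by norm_num) (Nat.le_sub_one_of_lt i.2)⟩
  have h : s = r := (AddCircle.coe_eq_coe_iff_of_mem_Ico (a := 0)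
    ⟨(h0 j).1.trans hs.1, hs.2.trans_le (h0 j).2⟩ ⟨(h0 i).1.trans hr.1, hr.2.trans_le (h0 i).2⟩).1 hrs
  subst h
  have h1 : (i : ℕ) < j + 1 := by exact_mod_cast hr.1.trans_lt hs.2
  have h2 : (j : ℕ) < i + 1 := by exact_mod_cast hs.1.trans_lt hr.2
  exact hij (Fin.ext (by omega))

theorem LexCube.exists_mem_part (l : LexCube) : ∃ i, l ∈ part i := by
  rcases le_or_gt l third with h | h
  · exact ⟨0, h⟩
  rcases lt_or_ge l twoThirds with h' | h'
  · exact ⟨1, h, h'⟩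
  · exact ⟨2, h'⟩

theorem LexCube.part_lt {i j : Fin 3} (hij : i < j) {x y : LexCube} (hx : x ∈ part i)
    (hy : y ∈ part j) : x < y := by
  fin_cases i <;> fin_cases j <;> first | exact absurd hij (by decide) | skip
  · exact lt_of_le_of_lt hx hy.1
  · exact lt_of_le_of_lt hx (third_lt_twoThirds.trans_le hy)
  · exact lt_of_lt_of_le hx.2 hy

theorem LexCube.part_disjoint {i j : Fin 3} (hij : i ≠ j) : Disjoint (part i) (part j) := by
  rw [disjoint_left]
  intro x hi hj
  rcases hij.lt_or_gt with h | h
  · exact (part_lt h hi hj).false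
  · exact (part_lt h hj hi).false

/-- Every non-empty open interval of the cube contains a non-empty open interval which lies in one
of the parts. -/
theorem LexCube.exists_Ioo_subset_part {a b : LexCube} (h : a < b) :
    ∃ j a' b', a' < b' ∧ Ioo a' b' ⊆ Ioo a b ∧ Ioo a' b' ⊆ part j := by
  rcases lt_or_ge a third with h1 | h1
  · exact ⟨0, a, min b third, lt_min h h1, fun x hx => ⟨hx.1, hx.2.trans_le (min_le_left _ _)⟩,
      fun x hx => (hx.2.trans_le (min_le_right _ _)).le⟩
  rcases lt_or_ge a twoThirds with h2 | h2
  · exact ⟨1, a, min b twoThirds, lt_min h h2, fun x hx => ⟨hx.1, hx.2.trans_le (min_le_left _ _)⟩,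
      fun x hx => ⟨h1.trans_lt hx.1, hx.2.trans_le (min_le_right _ _)⟩⟩
  · exact ⟨2, a, b, h, Subset.rfl, fun x hx => h2.trans hx.1.le⟩

/-- Every part of the cube contains a non-empty open interval. -/
theorem LexCube.exists_Ioo_subset (j : Fin 3) : ∃ a b, a < b ∧ Ioo a b ⊆ part j := by
  have hb : ⊥ < third := (const_lt (c := ⟨0, by simp⟩) (Subtype.mk_lt_mk.2 (by norm_num))).bot_lt
  have ht : twoThirds < ⊤ :=
    (const_lt (d := ⟨1, by simp⟩) (Subtype.mk_lt_mk.2 (by norm_num))).lt_top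
  fin_cases j
  · exact ⟨⊥, third, hb, fun x hx => hx.2.le⟩
  · exact ⟨third, twoThirds, third_lt_twoThirds, Subset.rfl⟩
  · exact ⟨twoThirds, ⊤, ht, fun x hx => hx.1.le⟩

end Circle

/-! ### Size of the Bernstein pieces, and dense admissible maps. -/

namespace IsBernsteinRectangles

variable {A : Fin 3 → Set LexCube} {B : Fin 3 → Set Circle3}

theorem exists_mem_left (h : IsBernsteinRectangles A B) (l : LexCube) : ∃ i, l ∈ A i :=
  mem_iUnion.1 (h.left.union.ge (mem_univ l))

theorem exists_mem_right (h : IsBernsteinRectangles A B) (z : Circle3) : ∃ j, z ∈ B j :=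
  mem_iUnion.1 (h.right.union.ge (mem_univ z))

theorem continuum_le_left (h : IsBernsteinRectangles A B) (i : Fin 3) {a b : LexCube}
    (hab : a < b) : Cardinal.continuum ≤ Cardinal.mk ↥(A i ∩ Ioo a b) := by
  refine LexCube.continuum_le_mk_of_forall_inter hab fun u v _ huv _ => ?_
  have hZ : ¬ (univ : Set Circle3).Countable := fun hc => by
    have := Cardinal.le_aleph0_iff_set_countable.2 hc
    rw [Cardinal.mk_univ, Circle3.cardinal_mk] at this
    exact Cardinal.aleph0_lt_continuum.not_ge this
  obtain ⟨p, hp, hp'⟩ := ((h.meets (Icc u v ×ˢ univ) (isClosed_Icc.prod isClosed_univ)).resolve_left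
    (not_coveredByCountablyManyLines_prod
      (fun hc => LexCube.not_countable_Ioo huv (hc.mono Ioo_subset_Icc_self)) hZ)) i 0
  exact ⟨p.1, hp.1, hp'.1⟩

theorem right_inter_nonempty (h : IsBernsteinRectangles A B) (j : Fin 3) {P : Set Circle3}
    (hP : IsClosed P) (hc : ¬ P.Countable) : (P ∩ B j).Nonempty := by
  obtain ⟨p, hp, hp'⟩ := ((h.meets (univ ×ˢ P) (isClosed_univ.prod hP)).resolve_left
    (not_coveredByCountablyManyLines_prod
      (fun hc => LexCube.not_countable_Ioo LexCube.third_lt_twoThirds (hc.mono (subset_univ _)))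
      hc)) 0 j
  exact ⟨p.2, hp.2, hp'.2⟩

/-- A Cantor set inside the arc splits into continuum many disjoint Cantor sets, by fixing the
even-indexed bits; each of them meets `B j`. -/
theorem continuum_le_right (h : IsBernsteinRectangles A B) (j : Fin 3) {a b : ℝ} (hab : a < b) :
    Cardinal.continuum ≤ Cardinal.mk ↥(B j ∩ (fun r : ℝ => (r : Circle3)) '' Ioo a b) := by
  obtain ⟨a', h1, h2⟩ := exists_between hab
  obtain ⟨b', h3, h4⟩ := exists_between (lt_min h2 (lt_add_of_pos_right a' (by norm_num : (0 : ℝ) < 3)))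
  obtain ⟨c, hc, hcc, hci⟩ := isClosed_Icc.exists_nat_bool_injection_of_not_countable
    (fun h : (Icc a' b').Countable =>
      (Cardinal.le_aleph0_iff_set_countable.2 h).not_gt
        ((Cardinal.mk_Icc_real h3).symm ▸ Cardinal.aleph0_lt_continuum))
  have hinj : Function.Injective fun x => (c x : Circle3) := fun x y hxy =>
    hci (Circle3.coe_injOn_Icc (h4.trans_le (min_le_right _ _)) (hc ⟨x, rfl⟩) (hc ⟨y, rfl⟩) hxy)
  have hcont : Continuous fun x => (c x : Circle3) := (AddCircle.continuous_mk' 3).comp hcc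
  let w (x y : ℕ → Bool) : ℕ → Bool := fun n => if n % 2 = 0 then x (n / 2) else y (n / 2)
  have hw {x y x' y' : ℕ → Bool} (hxy : w x y = w x' y') : x = x' ∧ y = y' := by
    constructor <;> funext n
    · simpa [w] using congrFun hxy (2 * n)
    · have := congrFun hxy (2 * n + 1)
      simpa [w, Nat.add_mod, show (2 * n + 1) / 2 = n by omega] using this
  have hwc (x : ℕ → Bool) : Continuous (w x) := by
    refine continuous_pi fun n => ?_
    by_cases hn : n % 2 = 0
    · simpa [w, hn] using continuous_const
    · simpa [w, hn] using continuous_apply (n / 2)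
  have hP (x : ℕ → Bool) : (range (fun y => (c (w x y) : Circle3)) ∩ B j).Nonempty := by
    refine h.right_inter_nonempty j (isCompact_range (hcont.comp (hwc x))).isClosed fun hct => ?_
    have h5 := Cardinal.le_aleph0_iff_set_countable.2 hct
    rw [Cardinal.mk_range_eq _ fun y y' hy => (hw (hinj hy)).2] at h5
    exact h5.not_gt (by simpa using Cardinal.cantor Cardinal.aleph0)
  choose p hp hpB using hP
  choose y hy using hp
  have hpi : Function.Injective p := fun x x' hx => (hw (hinj ((hy x).trans (hx.trans (hy x').symm)))).1
  have hcard : Cardinal.mk (ℕ → Bool) = Cardinal.continuum := by simp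
  rw [← hcard]
  refine Cardinal.mk_le_of_injective (f := fun x => (⟨p x, hpB x, c (w x (y x)), ?_, hy x⟩ :
    ↥(B j ∩ (fun r : ℝ => (r : Circle3)) '' Ioo a b))) fun x x' hx => hpi (congrArg Subtype.val hx)
  have := hc ⟨w x (y x), rfl⟩
  exact ⟨h1.trans_le this.1, this.2.trans_lt (h4.trans_le (min_le_left _ _) )⟩

/-- There is an admissible map sending every non-empty open interval to a dense set. -/
theorem exists_glued_dense (h : IsBernsteinRectangles A B) :
    ∃ f : LexCube → Circle3, IsGluedFromBijections A B f ∧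
      ∀ a b, a < b → Dense (f '' Ioo a b) := by
  have key (i j : Fin 3) : ∃ f : LexCube → Circle3,
      BijOn f (A i ∩ LexCube.part j) (arc i ∩ B j) ∧
      ∀ a b, a < b → Ioo a b ⊆ LexCube.part j → ∀ r s : ℝ, r < s → i ≤ r → s ≤ i + 1 →
        ∃ l ∈ A i ∩ LexCube.part j ∩ Ioo a b, f l ∈ (fun r : ℝ => (r : Circle3)) '' Ioo r s := by
    let α := {p : (LexCube × LexCube) × (ℝ × ℝ) // p.1.1 < p.1.2 ∧
      Ioo p.1.1 p.1.2 ⊆ LexCube.part j ∧ p.2.1 < p.2.2 ∧ (i : ℝ) ≤ p.2.1 ∧ p.2.2 ≤ i + 1}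
    have hα : Cardinal.mk α ≤ Cardinal.continuum :=
      (Cardinal.mk_subtype_le _).trans (by simp [LexCube.cardinal_mk, Cardinal.mk_real])
    have hL {a b : LexCube} (hab : a < b) (hs : Ioo a b ⊆ LexCube.part j) :
        Cardinal.continuum ≤ Cardinal.mk ↥(A i ∩ LexCube.part j ∩ Ioo a b) :=
      (h.continuum_le_left i hab).trans
        (Cardinal.mk_le_mk_of_subset fun x hx => ⟨⟨hx.1, hs hx.2⟩, hx.2⟩)
    have hR {r s : ℝ} (hrs : r < s) (hr : (i : ℝ) ≤ r) (hs : s ≤ i + 1) :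
        Cardinal.continuum ≤ Cardinal.mk
          ↥(arc i ∩ B j ∩ (fun r : ℝ => (r : Circle3)) '' Ioo r s) := by
      refine (h.continuum_le_right j hrs).trans (Cardinal.mk_le_mk_of_subset fun x hx => ?_)
      refine ⟨⟨?_, hx.1⟩, hx.2⟩
      obtain ⟨t, ht, rfl⟩ := hx.2
      exact mem_arc_of_mem (hr.trans ht.1.le) (ht.2.trans_le hs)
    obtain ⟨a, b, hab, hs⟩ := LexCube.exists_Ioo_subset j
    obtain ⟨f, hf, hf'⟩ := exists_bijOn_meeting LexCube.cardinal_mk Circle3.cardinal_mk hα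
      ((hL hab hs).trans (Cardinal.mk_le_mk_of_subset inter_subset_left))
      ((hR (lt_add_one (i : ℝ)) le_rfl le_rfl).trans
        (Cardinal.mk_le_mk_of_subset inter_subset_left))
      (fun p : α => Ioo p.1.1.1 p.1.1.2) (fun p : α => (fun r : ℝ => (r : Circle3)) '' Ioo p.1.2.1 p.1.2.2)
      (fun p => hL p.2.1 p.2.2.1) (fun p => hR p.2.2.2.1 p.2.2.2.2.1 p.2.2.2.2.2)
    exact ⟨f, hf, fun a b hab hs r s hrs hr hs' => hf' ⟨((a, b), (r, s)), hab, hs, hrs, hr, hs'⟩⟩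
  choose F hF hFd using key
  choose i hi using h.exists_mem_left
  choose j hj using LexCube.exists_mem_part
  have hij {l : LexCube} {i' j' : Fin 3} (hl : l ∈ A i' ∩ LexCube.part j') :
      F i' j' l = F (i l) (j l) l := by
    obtain rfl : i' = i l := by_contra fun hne =>
      disjoint_left.1 (h.left.disjoint _ _ hne) hl.1 (hi l)
    obtain rfl : j' = j l := by_contra fun hne =>
      disjoint_left.1 (LexCube.part_disjoint hne) hl.2 (hj l)
    rfl
  refine ⟨fun l => F (i l) (j l) l, fun i' j' => (hF i' j').congr fun l hl => hij hl,
    fun a b hab => ?_⟩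
  rw [dense_iff_inter_open]
  rintro U hU ⟨z, hz⟩
  obtain ⟨k, r, ⟨hr1, hr2⟩, rfl⟩ := exists_mem_arc z
  have hU' : IsOpen ((fun r : ℝ => (r : Circle3)) ⁻¹' U) := hU.preimage (AddCircle.continuous_mk' 3)
  -- A right neighbourhood suffices, and it can be kept in arc `k`, which is closed on the left.
  obtain ⟨s, hs, hsU⟩ := (mem_nhdsGE_iff_exists_Ico_subset' (lt_add_one r)).1
    (mem_nhdsWithin_of_mem_nhds (hU'.mem_nhds hz))
  obtain ⟨j', a', b', hab', hsub, hp⟩ := LexCube.exists_Ioo_subset_part hab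
  obtain ⟨l, ⟨hl, hlab⟩, t, ht, htl⟩ :=
    hFd k j' a' b' hab' hp r (min s (k + 1)) (lt_min hs hr2) hr1 (min_le_right _ _)
  refine ⟨F k j' l, ?_, l, hsub hlab, (hij hl).symm⟩
  rw [← htl]
  exact hsU ⟨ht.1.le, ht.2.trans_le (min_le_left _ _)⟩

end IsBernsteinRectangles

/-! ### Reversal, concatenation and restriction of big paths. -/

section BigPaths

theorem IsBigInterval.exists_isGLB {L : Type*} [LinearOrder L] (h : IsBigInterval L) {S : Set L}
    (hS : S.Nonempty) : ∃ m, IsGLB S m := by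
  obtain ⟨a, ha⟩ := h.exists_min
  obtain ⟨s, hs⟩ := hS
  obtain ⟨m, hm⟩ := h.complete (lowerBounds S) ⟨a, fun x _ => ha.2 (mem_univ x)⟩ ⟨s, fun x hx => hx hs⟩
  exact ⟨m, isLUB_lowerBounds.1 hm⟩

theorem IsBigInterval.orderDual {L : Type*} [LinearOrder L] (h : IsBigInterval L) :
    IsBigInterval Lᵒᵈ where
  nontrivial := have := h.nontrivial; inferInstance
  dense x y hxy := let ⟨z, h1, h2⟩ := h.dense y.ofDual x.ofDual hxy; ⟨.toDual z, h2, h1⟩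
  complete _ hS _ := h.exists_isGLB (L := L) hS
  exists_min := h.exists_max
  exists_max := h.exists_min

variable {X : Type u} {t : TopologicalSpace X} {s : Set X} {x y z : X}

/-- The points `x` and `y` are joined by a big path in the subspace `s` of `(X, t)`. -/
def BigJoined (t : TopologicalSpace X) (s : Set X) (x y : X) : Prop :=
  ∃ (L : Type u) (_ : LinearOrder L) (_ : TopologicalSpace L),
    OrderTopology L ∧ IsBigInterval L ∧
    ∃ γ : L → X, Continuous γ ∧ (∀ l, γ l ∈ s) ∧
      (∀ a, IsLeast univ a → γ a = x) ∧ (∀ b, IsGreatest univ b → γ b = y)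

theorem BigJoined.symm (h : BigJoined t s x y) : BigJoined t s y x := by
  obtain ⟨L, _, _, _, hL, γ, hγ, hs, hx, hy⟩ := h
  exact ⟨Lᵒᵈ, inferInstance, inferInstance, inferInstance, hL.orderDual, γ ∘ OrderDual.ofDual,
    hγ.comp continuous_ofDual, fun l => hs l.ofDual, hy, hx⟩

/-- Two big intervals, the maximum of the first being glued to the minimum of the second. -/
def GluedInterval {L₁ L₂ : Type u} (b : L₁) (a : L₂) : Type u :=
  {p : L₁ ×ₗ L₂ // (ofLex p).1 = b ∨ (ofLex p).2 = a}

namespace GluedInterval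

variable {L₁ L₂ : Type u} {b : L₁} {a : L₂}

/-- The projection to the first interval. -/
def fst (p : GluedInterval b a) : L₁ := (ofLex p.1).1

/-- The projection to the second interval. -/
def snd (p : GluedInterval b a) : L₂ := (ofLex p.1).2

/-- The points of the first interval. -/
def inl (b : L₁) (a : L₂) (x : L₁) : GluedInterval b a := ⟨toLex (x, a), Or.inr rfl⟩

/-- The points of the second interval. -/
def inr (b : L₁) (a : L₂) (y : L₂) : GluedInterval b a := ⟨toLex (b, y), Or.inl rfl⟩

theorem fst_eq_or (p : GluedInterval b a) : p.fst = b ∨ p.snd = a := p.2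

variable [LinearOrder L₁] [LinearOrder L₂]

noncomputable instance : LinearOrder (GluedInterval b a) :=
  inferInstanceAs (LinearOrder {p : L₁ ×ₗ L₂ // (ofLex p).1 = b ∨ (ofLex p).2 = a})

theorem le_iff' {p q : GluedInterval b a} :
    p ≤ q ↔ p.fst < q.fst ∨ p.fst = q.fst ∧ p.snd ≤ q.snd :=
  Prod.Lex.le_iff (α := L₁) (β := L₂)

/-- On the L-shaped subset the lexicographic and product orders agree, so both projections are
monotone and suprema can be taken coordinatewise. -/
theorem le_iff (hb : ∀ x, x ≤ b) (ha : ∀ y, a ≤ y) {p q : GluedInterval b a} :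
    p ≤ q ↔ p.fst ≤ q.fst ∧ p.snd ≤ q.snd := by
  rw [le_iff']
  refine ⟨?_, fun ⟨h1, h2⟩ => h1.lt_or_eq.imp_right fun h => ⟨h, h2⟩⟩
  rintro (h | ⟨h1, h2⟩)
  · refine ⟨h.le, ?_⟩
    rw [p.fst_eq_or.resolve_left (h.trans_le (hb _)).ne]
    exact ha _
  · exact ⟨h1.le, h2⟩

theorem isBigInterval (h₁ : IsBigInterval L₁) (h₂ : IsBigInterval L₂) (hb : ∀ x, x ≤ b)
    (ha : ∀ y, a ≤ y) : IsBigInterval (GluedInterval b a) where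
  nontrivial := by
    obtain ⟨x, y, hxy⟩ := h₁.nontrivial
    exact ⟨inl b a x, inl b a y, fun h => hxy (congrArg fst h)⟩
  dense p q hpq := by
    have hn := not_le.2 hpq
    obtain ⟨h1, h2⟩ := (le_iff hb ha).1 hpq.le
    rcases h1.lt_or_eq with h1 | h1
    · obtain ⟨z, hz1, hz2⟩ := h₁.dense _ _ h1
      refine ⟨inl b a z, lt_of_not_ge fun h => hz1.not_ge ((le_iff hb ha).1 h).1,
        lt_of_not_ge fun h => hz2.not_ge ((le_iff hb ha).1 h).1⟩
    · have h3 : p.snd < q.snd := h2.lt_of_not_ge fun h => hn ((le_iff hb ha).2 ⟨h1.ge, h⟩)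
      obtain ⟨z, hz1, hz2⟩ := h₂.dense _ _ h3
      exact ⟨inr b a z, lt_of_not_ge fun h => hz1.not_ge ((le_iff hb ha).1 h).2,
        lt_of_not_ge fun h => hz2.not_ge ((le_iff hb ha).1 h).2⟩
  complete S hS _ := by
    obtain ⟨c, hc⟩ := h₂.exists_max
    obtain ⟨m₁, hm₁⟩ := h₁.complete (fst '' S) (hS.image _) ⟨b, fun x _ => hb x⟩
    obtain ⟨m₂, hm₂⟩ := h₂.complete (snd '' S) (hS.image _) ⟨c, fun x _ => hc.2 (mem_univ x)⟩
    have hm : m₁ = b ∨ m₂ = a := by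
      refine or_iff_not_imp_left.2 fun h => (hm₂.2 ?_).antisymm (ha _)
      rintro _ ⟨p, hp, rfl⟩
      refine (p.fst_eq_or.resolve_left fun h' => h ?_).le
      exact (hb _).antisymm (h' ▸ hm₁.1 ⟨p, hp, rfl⟩)
    refine ⟨⟨toLex (m₁, m₂), hm⟩, fun p hp => ?_, fun u hu => ?_⟩
    · exact (le_iff hb ha).2 ⟨hm₁.1 ⟨p, hp, rfl⟩, hm₂.1 ⟨p, hp, rfl⟩⟩
    · refine (le_iff hb ha).2 ⟨hm₁.2 ?_, hm₂.2 ?_⟩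
      · rintro _ ⟨p, hp, rfl⟩
        exact ((le_iff hb ha).1 (hu hp)).1
      · rintro _ ⟨p, hp, rfl⟩
        exact ((le_iff hb ha).1 (hu hp)).2
  exists_min := by
    obtain ⟨c, hc⟩ := h₁.exists_min
    exact ⟨inl b a c, mem_univ _, fun p _ => (le_iff hb ha).2 ⟨hc.2 (mem_univ _), ha _⟩⟩
  exists_max := by
    obtain ⟨c, hc⟩ := h₂.exists_max
    exact ⟨inr b a c, mem_univ _, fun p _ => (le_iff hb ha).2 ⟨hb _, hc.2 (mem_univ _)⟩⟩

end GluedInterval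

theorem BigJoined.trans (h : BigJoined t s x y) (h' : BigJoined t s y z) : BigJoined t s x z := by
  classical
  obtain ⟨L₁, _, _, _, h₁, γ₁, hγ₁, hs₁, hx, hy₁⟩ := h
  obtain ⟨L₂, _, _, _, h₂, γ₂, hγ₂, hs₂, hy₂, hz⟩ := h'
  obtain ⟨b, hb⟩ := h₁.exists_max
  obtain ⟨a, ha⟩ := h₂.exists_min
  have hb' (x : L₁) : x ≤ b := hb.2 (mem_univ x)
  have ha' (x : L₂) : a ≤ x := ha.2 (mem_univ x)
  have : DenselyOrdered L₁ := ⟨h₁.dense⟩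
  have : DenselyOrdered L₂ := ⟨h₂.dense⟩
  let _ : TopologicalSpace (GluedInterval b a) := Preorder.topology _
  have : OrderTopology (GluedInterval b a) := ⟨rfl⟩
  have c1 : Continuous (GluedInterval.fst : GluedInterval b a → L₁) :=
    Monotone.continuous_of_surjective (fun p q h => ((GluedInterval.le_iff hb' ha').1 h).1)
      fun x => ⟨.inl b a x, rfl⟩
  have c2 : Continuous (GluedInterval.snd : GluedInterval b a → L₂) :=
    Monotone.continuous_of_surjective (fun p q h => ((GluedInterval.le_iff hb' ha').1 h).2)
      fun x => ⟨.inr b a x, rfl⟩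
  refine ⟨GluedInterval b a, inferInstance, inferInstance, inferInstance,
    GluedInterval.isBigInterval h₁ h₂ hb' ha',
    fun p => if GluedInterval.inl b a b ≤ p then γ₂ p.snd else γ₁ p.fst,
    Continuous.if_le (hγ₂.comp c2) (hγ₁.comp c1) continuous_const continuous_id ?_, ?_, ?_, ?_⟩
  · rintro p rfl
    exact (hy₂ a ha).trans (hy₁ b hb).symm
  · intro p
    dsimp only
    split_ifs
    exacts [hs₂ _, hs₁ _]
  · intro p hp
    obtain ⟨c, hc⟩ := h₁.exists_min
    have h3 := (GluedInterval.le_iff hb' ha').1 (hp.2 (mem_univ (GluedInterval.inl b a c)))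
    have h4 : IsLeast univ p.fst := ⟨mem_univ _, fun x _ => h3.1.trans (hc.2 (mem_univ x))⟩
    dsimp only
    rw [if_neg, hx _ h4]
    -- If the gluing point were the minimum, the first interval would reduce to a point.
    intro h5
    have h6 : b ≤ p.fst := ((GluedInterval.le_iff hb' ha').1 h5).1
    obtain ⟨u, v, huv⟩ := h₁.nontrivial
    have h7 (w : L₁) : w = b := (hb' w).antisymm (h6.trans (h4.2 (mem_univ w)))
    exact huv ((h7 u).trans (h7 v).symm)
  · intro p hp
    obtain ⟨c, hc⟩ := h₂.exists_max
    have h3 := (GluedInterval.le_iff hb' ha').1 (hp.2 (mem_univ (GluedInterval.inr b a c)))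
    have h4 : IsGreatest univ p.snd := ⟨mem_univ _, fun x _ => (hc.2 (mem_univ x)).trans h3.2⟩
    dsimp only
    rw [if_pos (hp.2 (mem_univ _)), hz _ h4]

theorem BigJoined.of_joinedIn {X : Type} {t : TopologicalSpace X} {s : Set X} {x y : X}
    (h : JoinedIn s x y) : BigJoined t s x y := by
  obtain ⟨γ, hγ⟩ := h
  refine ⟨unitInterval, inferInstance, inferInstance, inferInstance, isBigInterval_unitInterval,
    γ, γ.continuous, hγ, fun a ha => ?_, fun b hb => ?_⟩
  · rw [le_antisymm (ha.2 (mem_univ 0)) unitInterval.nonneg', γ.source]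
  · rw [le_antisymm unitInterval.le_one' (hb.2 (mem_univ 1)), γ.target]

/-- Clamping to `[a, b]` keeps all of `L` as the domain, so the subinterval need not be shown to be
a big interval. -/
theorem BigJoined.of_le {L X : Type} [LinearOrder L] [TopologicalSpace L] [OrderTopology L]
    (hL : IsBigInterval L) {t : TopologicalSpace X} {s : Set X} {f : L → X} (hf : Continuous f)
    {a b : L} (hab : a ≤ b) (hs : ∀ l ∈ Icc a b, f l ∈ s) : BigJoined t s (f a) (f b) := by
  refine ⟨L, inferInstance, inferInstance, inferInstance, hL, fun l => f (max a (min l b)),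
    hf.comp (continuous_const.max (continuous_id.min continuous_const)),
    fun l => hs _ ⟨le_max_left _ _, max_le hab (min_le_right _ _)⟩, fun l hl => ?_, fun l hl => ?_⟩
  · dsimp only
    rw [max_eq_left ((min_le_left _ _).trans (hl.2 (mem_univ a)))]
  · dsimp only
    rw [min_eq_right (hl.2 (mem_univ b)), max_eq_right hab]

end BigPaths

/-! ### Maps from the line with closed fibres; paths in the cube. -/

section ClosedFibres

variable {X : Type*} {φ : ℝ → X}

/-- The fibre of `φ p` is closed and relatively open in `J`. Local constancy is needed only on this
one fibre, which is all that the later applications can supply. -/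
theorem IsPreconnected.eq_of_eventually_eq (hφ : ∀ x, IsClosed (φ ⁻¹' {x})) {J : Set ℝ}
    (hJ : IsPreconnected J) {p : ℝ} (hp : p ∈ J)
    (h : ∀ s ∈ J, φ s = φ p → ∀ᶠ s' in 𝓝 s, φ s' = φ p) : ∀ s ∈ J, φ s = φ p := by
  have hsub := hJ.subset_of_closure_inter_subset (u := interior (φ ⁻¹' {φ p})) isOpen_interior
    ⟨p, hp, mem_interior_iff_mem_nhds.2 (h p hp rfl)⟩ fun s hs =>
      mem_interior_iff_mem_nhds.2 (h s hs.2 (closure_minimal interior_subset (hφ _) hs.1))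
  exact fun s hs => show s ∈ φ ⁻¹' {φ p} from interior_subset (hsub hs)

/-- Sierpiński: the line is not a countable union of disjoint closed sets in a nontrivial way. -/
theorem eq_of_countable_range (hφ : ∀ x, IsClosed (φ ⁻¹' {x})) (hc : (range φ).Countable)
    (s t : ℝ) : φ s = φ t := by
  suffices h : ∀ s, ∀ᶠ s' in 𝓝 s, φ s' = φ s from
    isPreconnected_univ.eq_of_eventually_eq hφ (mem_univ t) (fun s _ hs => hs ▸ h s) s (mem_univ s)
  by_contra hB
  -- By Baire's theorem some fibre contains all points of `B` in a ball around a point `s₀` of `B`.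
  -- Any other fibre meeting the ball contains no point of `B` there, so it would fill the ball;
  -- hence `φ` is constant near `s₀`, a contradiction.
  let B : Set ℝ := {s | ∀ᶠ s' in 𝓝 s, φ s' = φ s}ᶜ
  have hBc : IsClosed B := by
    refine IsOpen.isClosed_compl (isOpen_iff_mem_nhds.2 fun s hs => ?_)
    filter_upwards [eventually_eventually_nhds.2 hs, hs] with r hr hrs
    exact hr.mono fun q hq => hq.trans hrs.symm
  have : Nonempty B := let ⟨s, hs⟩ := not_forall.1 hB; ⟨⟨s, hs⟩⟩
  have : CompleteSpace B := hBc.completeSpace_coe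
  have := hc.to_subtype
  have hcover : ⋃ x : range φ, ((↑) ⁻¹' (φ ⁻¹' {x.1}) : Set B) = univ :=
    eq_univ_of_forall fun s => mem_iUnion.2 ⟨⟨φ s, s, rfl⟩, rfl⟩
  obtain ⟨x, ⟨s₀, hs₀⟩, hx⟩ := nonempty_interior_of_iUnion_of_closed
    (fun x : range φ => (hφ x.1).preimage continuous_subtype_val) hcover
  rw [mem_interior_iff_mem_nhds, mem_nhds_subtype] at hx
  obtain ⟨V, hV, hVx⟩ := hx
  obtain ⟨ε, hε, hεV⟩ := Metric.mem_nhds_iff.1 hV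
  have hVx' {r : ℝ} (hr : r ∈ B) (hrV : r ∈ V) : φ r = x := hVx (show ⟨r, hr⟩ ∈ _ from hrV)
  have hs₀x : φ s₀ = x := hVx' hs₀ (mem_of_mem_nhds hV)
  refine hs₀ (Filter.mem_of_superset (Metric.ball_mem_nhds s₀ hε) fun s hs => ?_)
  by_contra hne
  refine hne ((convex_ball s₀ ε).isPreconnected.eq_of_eventually_eq hφ hs (fun r hr hrs => ?_) s₀
    (Metric.mem_ball_self hε)).symm
  by_contra hr'
  rw [← hrs] at hr'
  exact hne (show φ s = φ s₀ from hrs.symm.trans ((hVx' hr' (hεV hr)).trans hs₀x.symm))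

theorem eq_of_countable_image_Icc (hφ : ∀ x, IsClosed (φ ⁻¹' {x})) {a b : ℝ}
    (hc : (φ '' Icc a b).Countable) {s t : ℝ} (hs : s ∈ Icc a b) (ht : t ∈ Icc a b) :
    φ s = φ t := by
  have hab : a ≤ b := hs.1.trans hs.2
  have hproj : Continuous fun r => (projIcc a b hab r : ℝ) :=
    continuous_subtype_val.comp continuous_projIcc
  have := eq_of_countable_range (φ := fun r => φ (projIcc a b hab r))
    (fun x => (hφ x).preimage hproj)
    (hc.mono (range_subset_iff.2 fun r => mem_image_of_mem φ (projIcc a b hab r).2)) s t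
  simpa [projIcc_of_mem hab hs, projIcc_of_mem hab ht] using this

end ClosedFibres

/-- The cube contains no nonconstant path. -/
theorem LexCube.eq_of_continuousOn_Ioo {ψ : ℝ → LexCube} {a b : ℝ} (h : ContinuousOn ψ (Ioo a b))
    {s t : ℝ} (hs : s ∈ Ioo a b) (ht : t ∈ Ioo a b) : ψ s = ψ t := by
  have key {s t : ℝ} (hs : s ∈ Ioo a b) (ht : t ∈ Ioo a b) : ¬ ψ s < ψ t := by
    intro hlt
    obtain ⟨u, v, huv, hd⟩ := exists_closed_subintervals hlt
    have hsub : uIcc s t ⊆ Ioo a b := ordConnected_Ioo.uIcc_subset hs ht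
    -- A nonconstant path would cross uncountably many disjoint open intervals, whose preimages are
    -- disjoint non-empty open sets of reals.
    have hcount : (univ : Set unitInterval).Countable := by
      refine PairwiseDisjoint.countable_of_isOpen (s := fun r => Ioo a b ∩ ψ ⁻¹' Ioo (u r) (v r))
        ?_ (fun r _ => h.isOpen_inter_preimage isOpen_Ioo isOpen_Ioo) fun r _ => ?_
      · have hdis {r r' : unitInterval} (hr : r < r') :
            Disjoint (Ioo a b ∩ ψ ⁻¹' Ioo (u r) (v r)) (Ioo a b ∩ ψ ⁻¹' Ioo (u r') (v r')) :=
          disjoint_left.2 fun q h1 h2 => (h1.2.2.trans ((hd r r' hr).trans h2.2.1)).false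
        intro r _ r' _ hne
        exact hne.lt_or_gt.elim hdis fun h => (hdis h).symm
      · obtain ⟨x, hx⟩ := exists_between (huv r).2.1
        obtain ⟨q, hq, rfl⟩ := intermediate_value_uIcc (h.mono hsub) (Icc_subset_uIcc
          ⟨((huv r).1.trans hx.1).le, (hx.2.trans (huv r).2.2).le⟩)
        exact ⟨q, hsub hq, hx⟩
    have h1 := Cardinal.le_aleph0_iff_set_countable.2 hcount
    rw [Cardinal.mk_univ, show Cardinal.mk unitInterval = _ from Cardinal.mk_Icc_real one_pos] at h1
    exact Cardinal.aleph0_lt_continuum.not_ge h1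
  exact le_antisymm (not_lt.1 (key ht hs)) (not_lt.1 (key hs ht))

/-! ### Admissible maps: bijectivity, and neighbourhoods missing a part or an arc. -/

namespace IsGluedFromBijections

variable {A : Fin 3 → Set LexCube} {B : Fin 3 → Set Circle3} {f : LexCube → Circle3}

theorem apply_mem_arc (hf : IsGluedFromBijections A B f) {i : Fin 3} {l : LexCube} (hl : l ∈ A i) :
    f l ∈ arc i :=
  let ⟨j, hj⟩ := l.exists_mem_part
  ((hf i j).mapsTo ⟨hl, hj⟩).1

theorem mem_part (hf : IsGluedFromBijections A B f) (h : IsBernsteinRectangles A B) {j : Fin 3}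
    {l : LexCube} (hl : f l ∈ B j) : l ∈ LexCube.part j := by
  obtain ⟨i, hi⟩ := h.exists_mem_left l
  obtain ⟨j', hj'⟩ := l.exists_mem_part
  obtain rfl : j' = j := by_contra fun hne =>
    disjoint_left.1 (h.right.disjoint _ _ hne) ((hf i j').mapsTo ⟨hi, hj'⟩).2 hl
  exact hj'

theorem bijective (hf : IsGluedFromBijections A B f) (h : IsBernsteinRectangles A B) :
    Function.Bijective f := by
  refine ⟨fun l l' hll => ?_, fun z => ?_⟩
  · obtain ⟨i, hi⟩ := h.exists_mem_left l
    obtain ⟨i', hi'⟩ := h.exists_mem_left l'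
    obtain ⟨j, hj⟩ := h.exists_mem_right (f l)
    obtain rfl : i = i' := by_contra fun hne =>
      disjoint_left.1 (arc_disjoint hne) (hf.apply_mem_arc hi) (hll ▸ hf.apply_mem_arc hi')
    exact (hf i j).injOn ⟨hi, hf.mem_part h hj⟩ ⟨hi', hf.mem_part h (hll ▸ hj)⟩ hll
  · obtain ⟨i, hi⟩ := exists_mem_arc z
    obtain ⟨j, hj⟩ := h.exists_mem_right z
    exact let ⟨l, _, hl⟩ := (hf i j).surjOn ⟨hi, hj⟩; ⟨l, hl⟩

end IsGluedFromBijections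

theorem exists_nhds_disjoint_part (l : LexCube) : ∃ j, ∃ W, IsOpen W ∧ l ∈ W ∧
    Disjoint W (LexCube.part j) := by
  rcases lt_or_ge l LexCube.twoThirds with h | h
  · exact ⟨2, Iio _, isOpen_Iio, h,
      disjoint_left.2 fun x (h1 : x < LexCube.twoThirds) (h2 : LexCube.twoThirds ≤ x) =>
        (h1.trans_le h2).false⟩
  · exact ⟨0, Ioi LexCube.third, isOpen_Ioi, LexCube.third_lt_twoThirds.trans_le h,
      disjoint_left.2 fun x (h1 : LexCube.third < x) (h2 : x ≤ LexCube.third) =>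
        (h1.trans_le h2).false⟩

theorem exists_nhds_disjoint_arc (z : Circle3) : ∃ i, ∃ U, IsOpen U ∧ z ∈ U ∧
    Disjoint U (arc i) := by
  have key (a r : ℝ) (i : Fin 3) (h1 : a < r) (h2 : r < a + 2)
      (hi : (i : ℝ) = a + 2 ∨ (i : ℝ) = a - 1) : ∃ i, ∃ U, IsOpen U ∧ (r : Circle3) ∈ U ∧
      Disjoint U (arc i) := by
    -- The open arc `(a, a + 2)` misses `[a + 2, a + 3)`, which modulo 3 is also `[a - 1, a)`.
    refine ⟨i, _, QuotientAddGroup.isOpenMap_coe _ isOpen_Ioo, ⟨r, ⟨h1, h2⟩, rfl⟩, ?_⟩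
    rw [disjoint_left]
    rintro _ ⟨u, hu, rfl⟩ ⟨v, hv, huv⟩
    have hper (x : ℝ) : ((x + 3 : ℝ) : Circle3) = x := AddCircle.coe_add_period 3 x
    rcases hi with hi | hi
    · rw [hi] at hv
      have := (AddCircle.coe_eq_coe_iff_of_mem_Ico (p := (3 : ℝ)) (a := a) (x := v) (y := u)
        ⟨by linarith [hv.1], by linarith [hv.2]⟩ ⟨hu.1.le, by linarith [hu.2]⟩).1 huv
      linarith [hv.1, hu.2]
    · rw [hi] at hv
      have := (AddCircle.coe_eq_coe_iff_of_mem_Ico (p := (3 : ℝ)) (a := a) (x := v + 3) (y := u)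
        ⟨by linarith [hv.1], by linarith [hv.2]⟩ ⟨hu.1.le, by linarith [hu.2]⟩).1
          ((hper v).trans huv)
      linarith [hv.1, hu.2]
  obtain ⟨r, ⟨h0, h3⟩, rfl⟩ := (AddCircle.coe_image_Ico_eq (3 : ℝ) 0).ge (mem_univ z)
  rcases lt_or_ge 1 r with h1 | h1
  · exact key 1 r 0 h1 (by linarith) (by norm_num)
  rcases h0.lt_or_eq with h0 | rfl
  · exact key 0 r 2 h0 (by linarith) (by norm_num)
  · exact key (-1) 0 1 (by norm_num) (by norm_num) (by norm_num)

/-! ### Paths in the mixed topology are Euclidean paths. -/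

section MixedPaths

open Filter

variable {A : Fin 3 → Set LexCube} {B : Fin 3 → Set Circle3} {f : LexCube → Circle3}
  {ψ : ℝ → LexCube}

theorem isClosed_mixedTopology_iff {P : Set Circle3} :
    IsClosed[mixedTopology f] P ↔ IsClosed P ∧ IsClosed (f ⁻¹' P) := by
  rw [← @isOpen_compl_iff _ _ (mixedTopology f), ← isOpen_compl_iff, ← isOpen_compl_iff]
  rfl

/-- A path in the mixed topology is at each time continuous in the sense of the circle or of the
cube. -/
theorem eventually_mem_or_mem (hf : Function.Bijective f)
    (hψ : Continuous[_, mixedTopology f] (f ∘ ψ)) {s : ℝ} {U : Set Circle3} {W : Set LexCube}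
    (hU : U ∈ 𝓝 (f (ψ s))) (hW : W ∈ 𝓝 (ψ s)) : ∀ᶠ r in 𝓝 s, f (ψ r) ∈ U ∨ ψ r ∈ W := by
  by_contra hn
  obtain ⟨x, hxs, hx⟩ := exists_seq_forall_of_frequently (not_eventually.1 hn)
  simp only [not_or] at hx
  obtain ⟨m, -, α, hα, hm⟩ := (isSeqCompact_univ (X := LexCube)) (x := fun n => ψ (x n))
    fun n => mem_univ _
  obtain ⟨w, -, β, hβ, hw⟩ := (isSeqCompact_univ (X := Circle3)) (x := fun n => f (ψ (x (α n))))
    fun n => mem_univ _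
  obtain ⟨w', rfl⟩ := hf.2 w
  have hm' : Tendsto (fun n => ψ (x (α (β n)))) atTop (𝓝 m) := hm.comp hβ.tendsto_atTop
  have hxs' : Tendsto (fun n => x (α (β n))) atTop (𝓝 s) :=
    hxs.comp (hα.tendsto_atTop.comp hβ.tendsto_atTop)
  -- Adding both limits makes `P` compact in the circle and its preimage compact in the cube. So `P`
  -- is mixed-closed and contains `f (ψ s)`; each way of belonging to it contradicts the choice of
  -- the sequence.
  let P : Set Circle3 := insert (f m) (insert (f w') (range fun n => f (ψ (x (α (β n))))))
  have hP : IsClosed[mixedTopology f] P := by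
    refine isClosed_mixedTopology_iff.2 ⟨(hw.isCompact_insert_range.insert _).isClosed, ?_⟩
    have : f ⁻¹' P = insert w' (insert m (range fun n => ψ (x (α (β n))))) := by
      ext l
      simp only [P, mem_preimage, mem_insert_iff, mem_range, hf.1.eq_iff]
      tauto
    rw [this]
    exact (hm'.isCompact_insert_range.insert _).isClosed
  have hPc : IsClosed ((f ∘ ψ) ⁻¹' P) := @IsClosed.preimage _ _ _ (mixedTopology f) _ hψ _ hP
  have hs : f (ψ s) ∈ P := hPc.mem_of_tendsto hxs'
    (Eventually.of_forall fun n => Or.inr (Or.inr ⟨n, rfl⟩))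
  have hUc : ∀ n, f (ψ (x (α (β n)))) ∉ U := fun n => (hx _).1
  have hWc : ∀ n, ψ (x (α (β n))) ∉ W := fun n => (hx _).2
  rcases hs with h | h | ⟨n, h⟩
  · rw [hf.1 h] at hW
    obtain ⟨n, hn⟩ := (hm'.eventually hW).exists
    exact hWc n hn
  · rw [h] at hU
    obtain ⟨n, hn⟩ := (hw.eventually hU).exists
    exact hUc n hn
  · rw [← show f (ψ (x (α (β n)))) = f (ψ s) from h] at hU
    exact hUc n (mem_of_mem_nhds hU)

theorem isClosed_fibre (hf : Function.Bijective f) (hψ : Continuous[_, mixedTopology f] (f ∘ ψ))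
    (l : LexCube) : IsClosed (ψ ⁻¹' {l}) := by
  have h : IsClosed[mixedTopology f] {f l} := by
    refine isClosed_mixedTopology_iff.2 ⟨isClosed_singleton, ?_⟩
    rw [← image_singleton, preimage_image_eq _ hf.1]
    exact isClosed_singleton
  have h' : IsClosed ((f ∘ ψ) ⁻¹' {f l}) := @IsClosed.preimage _ _ _ (mixedTopology f) _ hψ _ h
  rwa [preimage_comp, ← image_singleton, preimage_image_eq _ hf.1] at h'

/-- If `p` shares no coordinate with the graph over `Q`, `eventually_mem_or_mem` gives, around each
time, a neighbourhood of `p` missing the nearby graph; finitely many such times suffice. -/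
theorem exists_of_mem_closure_graph (hf : Function.Bijective f)
    (hψ : Continuous[_, mixedTopology f] (f ∘ ψ)) {Q : Set ℝ} (hQ : IsCompact Q)
    {p : LexCube × Circle3} (hp : p ∈ closure ((fun s => (ψ s, f (ψ s))) '' Q)) :
    ∃ s ∈ Q, ψ s = p.1 ∨ f (ψ s) = p.2 := by
  by_contra! h
  have : ∃ O ∈ 𝓝 p, ∀ s ∈ Q, (ψ s, f (ψ s)) ∉ O := by
    refine hQ.induction_on (p := fun T => ∃ O ∈ 𝓝 p, ∀ s ∈ T, (ψ s, f (ψ s)) ∉ O)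
      ⟨univ, univ_mem, by simp⟩ ?_ ?_ ?_
    · rintro s t hst ⟨O, hO, h⟩
      exact ⟨O, hO, fun r hr => h r (hst hr)⟩
    · rintro s t ⟨O, hO, h⟩ ⟨O', hO', h'⟩
      exact ⟨O ∩ O', inter_mem hO hO', fun r hr hrO =>
        hr.elim (fun hr => h r hr hrO.1) fun hr => h' r hr hrO.2⟩
    · intro s hs
      obtain ⟨h1, h2⟩ := h s hs
      obtain ⟨W, W', hW, hW', hsW, hpW, hWd⟩ := t2_separation h1
      obtain ⟨U, U', hU, hU', hsU, hpU, hUd⟩ := t2_separation h2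
      refine ⟨_, mem_nhdsWithin_of_mem_nhds
        (eventually_mem_or_mem hf hψ (hU.mem_nhds hsU) (hW.mem_nhds hsW)), W' ×ˢ U',
        (hW'.prod hU').mem_nhds ⟨hpW, hpU⟩, fun r hr hrO => ?_⟩
      exact hr.elim (fun hr => disjoint_left.1 hUd hr hrO.2) fun hr => disjoint_left.1 hWd hr hrO.1
  obtain ⟨O, hO, hOQ⟩ := this
  obtain ⟨_, hpO, s, hs, rfl⟩ := mem_closure_iff_nhds.1 hp O hO
  exact hOQ s hs hpO

/-- A path in the mixed topology which avoids a part of the cube and an arc is constant. -/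
theorem eq_of_avoids_part_of_avoids_arc (hf : IsGluedFromBijections A B f)
    (h : IsBernsteinRectangles A B) (hψ : Continuous[_, mixedTopology f] (f ∘ ψ)) {a b : ℝ}
    {i j : Fin 3} (hij : ∀ s ∈ Icc a b, ψ s ∉ LexCube.part j ∧ f (ψ s) ∉ arc i) {s t : ℝ}
    (hs : s ∈ Icc a b) (ht : t ∈ Icc a b) : ψ s = ψ t := by
  have hfb := hf.bijective h
  refine eq_of_countable_image_Icc (isClosed_fibre hfb hψ) ?_ hs ht
  rcases h.meets (closure ((fun s => (ψ s, f (ψ s))) '' Icc a b)) isClosed_closure with hc | hm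
  · obtain ⟨P, Q, hP, hQ, hPQ⟩ := hc.exists_countable
    refine (hP.union (hQ.preimage hfb.1)).mono ?_
    rintro _ ⟨r, hr, rfl⟩
    exact hPQ _ (subset_closure ⟨r, hr, rfl⟩)
  · obtain ⟨p, hp, hpA, hpB⟩ := hm i j
    obtain ⟨r, hr, hr' | hr'⟩ := exists_of_mem_closure_graph hfb hψ isCompact_Icc hp
    · exact absurd (hf.apply_mem_arc (hr' ▸ hpA)) (hij r hr).2
    · exact absurd (hf.mem_part h (hr' ▸ hpB)) (hij r hr).1

theorem eventually_eq_of_avoids (hf : IsGluedFromBijections A B f)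
    (h : IsBernsteinRectangles A B) (hψ : Continuous[_, mixedTopology f] (f ∘ ψ)) {s : ℝ}
    {i j : Fin 3} (hij : ∀ᶠ r in 𝓝 s, ψ r ∉ LexCube.part j ∧ f (ψ r) ∉ arc i) :
    ∀ᶠ r in 𝓝 s, ψ r = ψ s := by
  obtain ⟨ε, hε, hεs⟩ := Metric.nhds_basis_closedBall.mem_iff.1 hij
  refine mem_of_superset (Metric.closedBall_mem_nhds s hε) fun r hr => ?_
  have hs := Metric.mem_closedBall_self (x := s) hε.le
  rw [Real.closedBall_eq_Icc] at hr hεs hs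
  exact eq_of_avoids_part_of_avoids_arc hf h hψ hεs hr hs

/-- A path in the mixed topology which avoids a part of the cube is constant. -/
theorem eq_of_avoids_part (hf : IsGluedFromBijections A B f)
    (h : IsBernsteinRectangles A B) (hψ : Continuous[_, mixedTopology f] (f ∘ ψ)) {a b : ℝ}
    {j : Fin 3} (hj : ∀ s ∈ Ioo a b, ψ s ∉ LexCube.part j) {s t : ℝ}
    (hs : s ∈ Ioo a b) (ht : t ∈ Ioo a b) : ψ s = ψ t := by
  have hfb := hf.bijective h
  refine LexCube.eq_of_continuousOn_Ioo (fun s hs => ContinuousAt.continuousWithinAt ?_) hs ht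
  clear! t
  by_contra hcont
  obtain ⟨W, ⟨hW, hWc⟩, hWn⟩ := by
    simpa only [ContinuousAt, (closed_nhds_basis (ψ s)).tendsto_right_iff, not_forall] using hcont
  obtain ⟨i, U, hU, hsU, hUi⟩ := exists_nhds_disjoint_arc (f (ψ s))
  obtain ⟨ε, hε, hεs⟩ := Metric.mem_nhds_iff.1 (inter_mem (Ioo_mem_nhds hs.1 hs.2)
    (eventually_mem_or_mem hfb hψ (hU.mem_nhds hsU) hW))
  obtain ⟨p, hpW, hp⟩ := ((not_eventually.1 hWn).and_eventually (Metric.ball_mem_nhds s hε)).exists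
  -- Outside the closed set `W` the path must be in `U`, and this persists nearby, so there it
  -- avoids arc `i` as well as part `j`. It is thus stuck at `ψ p`, and never reaches `ψ s`, which
  -- lies in `W`.
  have hconst := (convex_ball s ε).isPreconnected.eq_of_eventually_eq (isClosed_fibre hfb hψ) hp
    (fun r hr hrp => ?_) s (Metric.mem_ball_self hε)
  · exact hpW (hconst ▸ mem_of_mem_nhds hW)
  · rw [← hrp] at hpW ⊢
    have hrU : f (ψ r) ∈ U := (hεs hr).2.resolve_right hpW
    refine eventually_eq_of_avoids hf h hψ (i := i) (j := j) ?_
    filter_upwards [Metric.isOpen_ball.mem_nhds hr,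
      eventually_mem_or_mem hfb hψ (hU.mem_nhds hrU) (hWc.isOpen_compl.mem_nhds hpW)] with q hq hq'
    exact ⟨hj q (hεs hq).1, disjoint_left.1 hUi (hq'.elim id fun hqW => (hεs hq).2.resolve_right hqW)⟩

/-- Every path in the mixed topology is continuous in the Euclidean topology. -/
theorem continuous_of_continuous_mixedTopology (hf : IsGluedFromBijections A B f)
    (h : IsBernsteinRectangles A B) (hψ : Continuous[_, mixedTopology f] (f ∘ ψ)) :
    Continuous (f ∘ ψ) := by
  have hfb := hf.bijective h
  refine continuous_iff_continuousAt.2 fun s => ?_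
  by_contra hcont
  obtain ⟨U, ⟨hU, hUc⟩, hUn⟩ := by
    simpa only [ContinuousAt, (closed_nhds_basis ((f ∘ ψ) s)).tendsto_right_iff, not_forall]
      using hcont
  obtain ⟨j, W, hW, hsW, hWj⟩ := exists_nhds_disjoint_part (ψ s)
  obtain ⟨ε, hε, hεs⟩ := Metric.mem_nhds_iff.1
    (eventually_mem_or_mem hfb hψ hU (hW.mem_nhds hsW))
  obtain ⟨p, hpU, hp⟩ := ((not_eventually.1 hUn).and_eventually (Metric.ball_mem_nhds s hε)).exists
  -- The same argument with circle and cube exchanged: outside `U` the path is in `W`, so it locally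
  -- avoids part `j`.
  have hconst := (convex_ball s ε).isPreconnected.eq_of_eventually_eq (isClosed_fibre hfb hψ) hp
    (fun r hr hrp => ?_) s (Metric.mem_ball_self hε)
  · refine hpU ?_
    rw [Function.comp_apply, ← hconst]
    exact mem_of_mem_nhds hU
  · rw [Function.comp_apply, ← hrp] at hpU
    rw [← hrp]
    have hrW : ψ r ∈ W := (hεs hr).resolve_left hpU
    have hev : ∀ᶠ q in 𝓝 r, ψ q ∉ LexCube.part j := by
      filter_upwards [Metric.isOpen_ball.mem_nhds hr,
        eventually_mem_or_mem hfb hψ (hUc.isOpen_compl.mem_nhds hpU) (hW.mem_nhds hrW)] with q hq hq'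
      exact disjoint_left.1 hWj (hq'.elim (fun hqU => (hεs hq).resolve_left hqU) id)
    obtain ⟨δ, hδ, hδr⟩ := Metric.mem_nhds_iff.1 hev
    refine mem_of_superset (Metric.ball_mem_nhds r hδ) fun q hq => ?_
    have hrδ := Metric.mem_ball_self (x := r) hδ
    rw [Real.ball_eq_Ioo] at hq hδr hrδ
    exact eq_of_avoids_part hf h hψ hδr hq hrδ

theorem continuous_mixedTopology_iff (hf : IsGluedFromBijections A B f)
    (h : IsBernsteinRectangles A B) (g : unitInterval → Circle3) :
    Continuous[_, mixedTopology f] g ↔ Continuous g := by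
  constructor
  · intro hg
    choose k hk using (hf.bijective h).2
    have h01 : (0 : ℝ) ≤ 1 := zero_le_one
    let ψ : ℝ → LexCube := fun s => k (g (projIcc 0 1 h01 s))
    have hfψ : f ∘ ψ = g ∘ projIcc 0 1 h01 := funext fun s => hk _
    have hψ : Continuous[_, mixedTopology f] (f ∘ ψ) := by
      rw [hfψ]
      exact @Continuous.comp _ _ _ _ _ (mixedTopology f) _ _ hg continuous_projIcc
    have h1 := (continuous_of_continuous_mixedTopology hf h hψ).comp
      (continuous_subtype_val (p := (· ∈ unitInterval)))
    rw [hfψ] at h1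
    convert h1 using 1
    funext s
    simp [projIcc_val]
  · exact fun hg => continuous_def.2 fun U hU => hU.1.preimage hg

end MixedPaths

/-! ### Removing one or two points from the Euclidean circle. -/

section Circle

theorem Circle3.exists_rep_pair {x y : Circle3} (hxy : x ≠ y) :
    ∃ r s : ℝ, r < s ∧ s < r + 3 ∧ (r : Circle3) = x ∧ (s : Circle3) = y := by
  obtain ⟨r, -, rfl⟩ := (AddCircle.coe_image_Ico_eq (3 : ℝ) 0).ge (mem_univ x)
  obtain ⟨s, hs, rfl⟩ := (AddCircle.coe_image_Ico_eq (3 : ℝ) r).ge (mem_univ y)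
  exact ⟨r, s, hs.1.lt_of_ne fun h => hxy (congrArg _ h), hs.2, rfl, rfl⟩

theorem Circle3.coe_ne {a r s : ℝ} (hr : r ∈ Ico a (a + 3)) (hs : s ∈ Ico a (a + 3)) (h : r ≠ s) :
    (r : Circle3) ≠ s := fun hrs =>
  h ((AddCircle.coe_eq_coe_iff_of_mem_Ico hr hs).1 hrs)

theorem Circle3.isPathConnected_image_Ioo {a b : ℝ} (h : a < b) :
    IsPathConnected ((fun r : ℝ => (r : Circle3)) '' Ioo a b) :=
  ((convex_Ioo a b).isPathConnected (nonempty_Ioo.2 h)).image (AddCircle.continuous_mk' 3)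

/-- The complement of two points of the circle consists of two disjoint open arcs. -/
theorem Circle3.exists_arcs {x y : Circle3} (hxy : x ≠ y) :
    ∃ a b c : ℝ, a < b ∧ b < c ∧
      Disjoint ((fun r : ℝ => (r : Circle3)) '' Ioo a b) ((fun r : ℝ => (r : Circle3)) '' Ioo b c) ∧
      (fun r : ℝ => (r : Circle3)) '' Ioo a b ∪ (fun r : ℝ => (r : Circle3)) '' Ioo b c =
        {x, y}ᶜ := by
  obtain ⟨r, s, hrs, hsr, rfl, rfl⟩ := exists_rep_pair hxy
  have hr : r ∈ Ico r (r + 3) := ⟨le_rfl, by linarith⟩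
  have hs : s ∈ Ico r (r + 3) := ⟨hrs.le, hsr⟩
  refine ⟨r, s, r + 3, hrs, hsr, disjoint_left.2 ?_, Subset.antisymm (union_subset ?_ ?_) ?_⟩
  · rintro _ ⟨u, hu, rfl⟩ ⟨v, hv, huv⟩
    exact coe_ne ⟨(hrs.trans hv.1).le, hv.2⟩ ⟨hu.1.le, hu.2.trans hsr⟩ (hu.2.trans hv.1).ne' huv
  · rintro _ ⟨u, hu, rfl⟩ (h | h)
    · exact coe_ne ⟨hu.1.le, hu.2.trans hsr⟩ hr hu.1.ne' h
    · exact coe_ne ⟨hu.1.le, hu.2.trans hsr⟩ hs hu.2.ne h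
  · rintro _ ⟨u, hu, rfl⟩ (h | h)
    · exact coe_ne ⟨(hrs.trans hu.1).le, hu.2⟩ hr (hrs.trans hu.1).ne' h
    · exact coe_ne ⟨(hrs.trans hu.1).le, hu.2⟩ hs hu.1.ne' h
  · intro z hz
    obtain ⟨u, hu, rfl⟩ := (AddCircle.coe_image_Ico_eq (3 : ℝ) r).ge (mem_univ z)
    have h1 : r < u := hu.1.lt_of_ne fun h => hz (Or.inl (congrArg _ h.symm))
    rcases lt_trichotomy u s with h | h | h
    · exact Or.inl ⟨u, ⟨h1, h⟩, rfl⟩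
    · exact absurd (Or.inr (congrArg _ h)) hz
    · exact Or.inr ⟨u, ⟨h, hu.2⟩, rfl⟩

theorem Circle3.isPathConnected_compl_singleton (x : Circle3) : IsPathConnected ({x}ᶜ) := by
  obtain ⟨r, -, rfl⟩ := (AddCircle.coe_image_Ico_eq (3 : ℝ) 0).ge (mem_univ x)
  have hr : r ∈ Ico r (r + 3) := ⟨le_rfl, by linarith⟩
  convert isPathConnected_image_Ioo (by linarith : r < r + 3) using 1
  refine Subset.antisymm (fun z hz => ?_) ?_
  · obtain ⟨u, hu, rfl⟩ := (AddCircle.coe_image_Ico_eq (3 : ℝ) r).ge (mem_univ z)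
    exact ⟨u, ⟨hu.1.lt_of_ne fun h => hz (congrArg _ h.symm), hu.2⟩, rfl⟩
  · rintro _ ⟨u, hu, rfl⟩ h
    exact coe_ne ⟨hu.1.le, hu.2⟩ hr hu.1.ne' h

theorem Circle3.not_isPathConnected_compl_pair {x y : Circle3} (hxy : x ≠ y) :
    ¬ IsPathConnected ({x, y}ᶜ) := by
  intro h
  obtain ⟨a, b, c, hab, hbc, hd, hu⟩ := exists_arcs hxy
  have hopen (a b : ℝ) : IsOpen ((fun r : ℝ => (r : Circle3)) '' Ioo a b) :=
    QuotientAddGroup.isOpenMap_coe _ isOpen_Ioo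
  have hne {a b : ℝ} (h : a < b) : ((fun r : ℝ => (r : Circle3)) '' Ioo a b).Nonempty :=
    (nonempty_Ioo.2 h).image _
  obtain ⟨z, -, h1, h2⟩ := h.isConnected.isPreconnected _ _ (hopen a b) (hopen b c) hu.ge
    ((hne hab).mono fun z hz => ⟨hu.le (Or.inl hz), hz⟩)
    ((hne hbc).mono fun z hz => ⟨hu.le (Or.inr hz), hz⟩)
  exact disjoint_left.1 hd h1 h2

end Circle

/-! ### Flimsiness for paths and its failure for big paths. -/

variable {A : Fin 3 → Set LexCube} {B : Fin 3 → Set Circle3} {f : LexCube → Circle3}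

theorem continuous_into_mixedTopology (f : LexCube → Circle3) : Continuous[_, mixedTopology f] f :=
  continuous_def.2 fun _ hU => hU.2

theorem JoinedIn.mixed (f : LexCube → Circle3) {s : Set Circle3} {x y : Circle3}
    (h : JoinedIn s x y) : @JoinedIn _ (mixedTopology f) s x y := by
  obtain ⟨γ, hγ⟩ := h
  exact ⟨@Path.mk _ (mixedTopology f) _ _ (@ContinuousMap.mk _ _ _ (mixedTopology f) γ
    (continuous_def.2 fun U hU => hU.1.preimage γ.continuous)) γ.source γ.target, hγ⟩

theorem isPathConnected_mixedTopology_iff (hf : IsGluedFromBijections A B f)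
    (h : IsBernsteinRectangles A B) (s : Set Circle3) :
    @IsPathConnected _ (mixedTopology f) s ↔ IsPathConnected s := by
  constructor
  · rintro ⟨x, hx, hj⟩
    refine ⟨x, hx, fun {y} hy => ?_⟩
    obtain ⟨γ, hγ⟩ := hj hy
    exact ⟨⟨⟨γ, (continuous_mixedTopology_iff hf h _).1
      (@Path.continuous _ (mixedTopology f) _ _ γ)⟩,
      @Path.source _ (mixedTopology f) _ _ γ, @Path.target _ (mixedTopology f) _ _ γ⟩, hγ⟩
  · rintro ⟨x, hx, hj⟩
    exact ⟨x, hx, fun {y} hy => (hj hy).mixed f⟩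

theorem two_lt_card_circle3 : ((2 : ℕ) : ℕ∞) < ENat.card Circle3 := by
  have : Infinite Circle3 :=
    Cardinal.infinite_iff.2 (Circle3.cardinal_mk ▸ Cardinal.aleph0_le_continuum)
  rw [ENat.card_eq_top_of_infinite]
  exact ENat.natCast_lt_top 2

theorem isPathFlimsy_mixedTopology (hf : IsGluedFromBijections A B f)
    (h : IsBernsteinRectangles A B) : IsPathFlimsy (mixedTopology f) 2 := by
  refine ⟨two_lt_card_circle3, fun S => ⟨fun hS => ?_, fun hS => ?_⟩⟩
  · rw [isPathConnected_mixedTopology_iff hf h]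
    rcases S.eq_empty_or_nonempty with rfl | ⟨x, hx⟩
    · rw [compl_empty]
      exact isPathConnected_univ
    · obtain rfl : S = {x} := by
        refine Subset.antisymm (fun y hy => ?_) (singleton_subset_iff.2 hx)
        exact encard_le_one_iff.1 (Order.le_of_lt_add_one (by simpa [one_add_one_eq_two] using hS)) y x hy hx
      exact Circle3.isPathConnected_compl_singleton x
  · rw [isPathConnected_mixedTopology_iff hf h]
    obtain ⟨x, y, hxy, rfl⟩ := encard_eq_two.1 (by simpa using hS)
    exact Circle3.not_isPathConnected_compl_pair hxy

theorem isBigPathConnected_compl_pair (hf : IsGluedFromBijections A B f)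
    (h : IsBernsteinRectangles A B) {x y : Circle3} (hxy : x ≠ y) :
    IsBigPathConnected (mixedTopology f) {x, y}ᶜ := by
  obtain ⟨a, b, c, hab, hbc, -, hu⟩ := Circle3.exists_arcs hxy
  let J := BigJoined (mixedTopology f) {x, y}ᶜ
  have harc {a b : ℝ} (hab : a < b) (hsub : (fun r : ℝ => (r : Circle3)) '' Ioo a b ⊆ {x, y}ᶜ)
      {z w : Circle3} (hz : z ∈ (fun r : ℝ => (r : Circle3)) '' Ioo a b)
      (hw : w ∈ (fun r : ℝ => (r : Circle3)) '' Ioo a b) : J z w :=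
    .of_joinedIn ((((Circle3.isPathConnected_image_Ioo hab).joinedIn _ hz _ hw).mono
      hsub).mixed f)
  have harc₁ := fun {z w} => harc hab (subset_union_left.trans hu.le) (z := z) (w := w)
  have harc₂ := fun {z w} => harc hbc (subset_union_right.trans hu.le) (z := z) (w := w)
  suffices hJ : ∃ z ∈ (fun r : ℝ => (r : Circle3)) '' Ioo a b,
      ∃ w ∈ (fun r : ℝ => (r : Circle3)) '' Ioo b c, J z w by
    obtain ⟨z, hz, w, hw, hzw⟩ := hJ
    intro p hp q hq
    rcases hu.ge hp with hp | hp <;> rcases hu.ge hq with hq | hq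
    · exact harc₁ hp hq
    · exact ((harc₁ hp hz).trans hzw).trans (harc₂ hw hq)
    · exact ((harc₂ hp hw).trans hzw.symm).trans (harc₁ hz hq)
    · exact harc₂ hp hq
  by_contra! hJ
  have hpt {a b : ℝ} (hab : a < b) (j : Fin 3) : ∃ l ∈ LexCube.part j,
      f l ∈ (fun r : ℝ => (r : Circle3)) '' Ioo a b := by
    have := Cardinal.mk_ne_zero_iff.1
      (Cardinal.continuum_pos.trans_le (h.continuum_le_right j hab)).ne'
    obtain ⟨z, hzB, hz⟩ := this
    obtain ⟨l, rfl⟩ := (hf.bijective h).2 z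
    exact ⟨l, hf.mem_part h hzB, hz⟩
  choose u hu₁ hu₂ using hpt hab
  choose v hv₁ hv₂ using hpt hbc
  obtain ⟨x', rfl⟩ := (hf.bijective h).2 x
  obtain ⟨y', rfl⟩ := (hf.bijective h).2 y
  have hf1 := (hf.bijective h).1
  have havoid {l : LexCube} : f l ∈ ({f x', f y'}ᶜ : Set Circle3) ↔ l ≠ x' ∧ l ≠ y' := by
    simp [hf1.eq_iff]
  -- The pair `(cx l, cy l)` records the side of each cut. Points with equal records, other than the
  -- cuts, are joined by a subinterval avoiding both cuts.
  let cx (l : LexCube) : ℕ := if l < x' then 0 else 1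
  let cy (l : LexCube) : ℕ := if l < y' then 0 else 1
  have hmono {l l' : LexCube} (hl : l ≤ l') : cx l ≤ cx l' ∧ cy l ≤ cy l' := by
    constructor <;> simp only [cx, cy] <;> split_ifs with h1 h2 h2 <;> simp
    all_goals exact h1 (hl.trans_lt h2)
  have hjoin {l l' : LexCube} (hl : f l ∈ ({f x', f y'}ᶜ : Set Circle3))
      (hl' : f l' ∈ ({f x', f y'}ᶜ : Set Circle3)) (hx : cx l = cx l') (hy : cy l = cy l') :
      J (f l) (f l') := by
    have key {l l' : LexCube} (hl : f l ∈ ({f x', f y'}ᶜ : Set Circle3)) (hx : cx l = cx l')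
        (hy : cy l = cy l') (hll : l ≤ l') : J (f l) (f l') := by
      refine BigJoined.of_le (t := mixedTopology f) LexCube.isBigInterval
        (continuous_into_mixedTopology f) hll fun m hm => havoid.2 ⟨?_, ?_⟩
      · rintro rfl
        simp [cx, hm.1.lt_of_ne (havoid.1 hl).1, hm.2.not_gt] at hx
      · rintro rfl
        simp [cy, hm.1.lt_of_ne (havoid.1 hl).2, hm.2.not_gt] at hy
    rcases le_total l l' with hll | hll
    · exact key hl hx hy hll
    · exact (key hl' hx.symm hy.symm hll).symm
  have hsep (i : Fin 3) : cx (u i) ≠ cx (v i) ∨ cy (u i) ≠ cy (v i) := by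
    by_contra! hc
    exact hJ _ (hu₂ i) _ (hv₂ i) (hjoin (hu.le (Or.inl (hu₂ i))) (hu.le (Or.inr (hv₂ i))) hc.1 hc.2)
  have hlt {i j : Fin 3} (hij : i < j) {l l' : LexCube} (hl : l ∈ LexCube.part i)
      (hl' : l' ∈ LexCube.part j) := hmono (LexCube.part_lt hij hl hl').le
  have h01 : (0 : Fin 3) < 1 := by decide
  have h12 : (1 : Fin 3) < 2 := by decide
  have := hsep 0
  have := hsep 1
  have := hsep 2
  have := hlt h01 (hu₁ 0) (hu₁ 1)
  have := hlt h01 (hu₁ 0) (hv₁ 1)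
  have := hlt h01 (hv₁ 0) (hu₁ 1)
  have := hlt h01 (hv₁ 0) (hv₁ 1)
  have := hlt h12 (hu₁ 1) (hu₁ 2)
  have := hlt h12 (hu₁ 1) (hv₁ 2)
  have := hlt h12 (hv₁ 1) (hu₁ 2)
  have := hlt h12 (hv₁ 1) (hv₁ 2)
  have hc (l : LexCube) : cx l ≤ 1 ∧ cy l ≤ 1 := by
    constructor <;> simp only [cx, cy] <;> split_ifs <;> simp
  have := hc (u 0)
  have := hc (v 0)
  have := hc (u 2)
  have := hc (v 2)
  -- Pigeonhole: by monotonicity a cut separating `u i` from `v i` has all earlier parts on one side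
  -- and all later ones on the other. So two cuts cannot separate the pairs in all three parts.
  omega

theorem mainTheorem7 :
    IsBigInterval LexCube ∧
    (∃ (A : Fin 3 → Set LexCube) (B : Fin 3 → Set Circle3), IsBernsteinRectangles A B) ∧
    ∀ (A : Fin 3 → Set LexCube) (B : Fin 3 → Set Circle3), IsBernsteinRectangles A B →
      (∃ f : LexCube → Circle3, IsGluedFromBijections A B f ∧
        IsEverywhereDenseHamiltonianBigPath euclideanTopology (mixedTopology f) f) ∧
      ∀ f : LexCube → Circle3, IsGluedFromBijections A B f →
        Function.Bijective f ∧ Continuous[_, mixedTopology f] f ∧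
        -- the new topology is coarser than the Euclidean one and has the same paths
        (∀ U : Set Circle3, IsOpen[mixedTopology f] U → IsOpen[euclideanTopology] U) ∧
        (∀ g : unitInterval → Circle3,
          Continuous[_, mixedTopology f] g ↔ Continuous[_, euclideanTopology] g) ∧
        IsPathFlimsy (mixedTopology f) 2 ∧
        (∀ x y : Circle3, x ≠ y → IsBigPathConnected (mixedTopology f) {x, y}ᶜ) ∧
        ¬ IsBigPathFlimsy (mixedTopology f) 2 := by
  refine ⟨LexCube.isBigInterval,
    exists_isBernsteinRectangles LexCube.cardinal_mk Circle3.cardinal_mk, fun A B h => ⟨?_, ?_⟩⟩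
  · obtain ⟨f, hf, hd⟩ := h.exists_glued_dense
    exact ⟨f, hf, LexCube.isBigInterval, continuous_into_mixedTopology f, hf.bijective h, hd⟩
  · intro f hf
    have hbig (x y : Circle3) (hxy : x ≠ y) := isBigPathConnected_compl_pair hf h hxy
    refine ⟨hf.bijective h, continuous_into_mixedTopology f, fun U hU => hU.1,
      continuous_mixedTopology_iff hf h, isPathFlimsy_mixedTopology hf h, hbig, fun hfl => ?_⟩
    obtain ⟨i, j, hij⟩ : ∃ x y : Circle3, x ≠ y :=
      ⟨f LexCube.third, f LexCube.twoThirds,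
        fun h' => LexCube.third_lt_twoThirds.ne ((hf.bijective h).1 h')⟩
    exact (hfl.2 {i, j}).2 (by simpa using encard_pair hij) (hbig i j hij)
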